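/- **Theorem 3.1 (Generalized Reciprocity Formula).** Let $\chi_1,\chi_2$ be primitive Dirichlet characters modulo $q_1,q_2\ge 1$ (the trivial character being the primitive character modulo $1$), with $q_1q_2>1$ and $\chi_1(-1)\chi_2(-1)=1$. Put $N=q_1q_2$, and let $N=QR$ with $Q,R\geq 1$ and $(Q,R)=1$. *Characters.* Any character $\chi$ modulo a divisor $q$ of $N$ factors uniquely as $\chi=\chi^{(Q)}\chi^{(R)}$ with $\chi^{(Q)},\chi^{(R)}$ characters modulo $q^{(Q)}:=(q,Q)$ and $q^{(R)}:=(q,R)$. Let $\chi_1'=\chi_2^{(Q)}\chi_1^{(R)}$ and $\chi_2'=\chi_1^{(Q)}\chi_2^{(R)}$, which are characters modulo $q_1'=q_2^{(Q)}q_1^{(R)}$ and $q_2'=q_1^{(Q)}q_2^{(R)}$. Let $\psi=\chi_1\overline{\chi_2}$ and $\psi'=\chi_1'\overline{\chi_2'}$ (characters modulo $N$), and for $\gamma\in\Gamma_0(N)$ with lower right entry $d$ write $\psi(\gamma)=\psi(d)$, $\psi'(\gamma)=\psi'(d)$. Write $e(x)=e^{2\pi i x}$, $\tau(\chi)=\sum_{n\bmod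 q}\chi(n)e(n/q)$ for $\chi$ modulo $q$, and $\delta_P=1$ or $0$ according to whether $P$ holds. *Dedekind sums.* For $z$ in the upper half-plane $\mathbb H$ let $$F_{\chi_1,\chi_2}(z)=\delta_{q_1=1}\frac{q_2^2L(2,\chi_2)}{2\pi i\,\tau(\chi_2)}\,z+\delta_{q_2=1}\tfrac12L(1,\chi_1)+\sum_{n\ge1}\frac{\lambda_{\chi_1,\chi_2}(n,1)}{\sqrt n}\,e(nz),\qquad \lambda_{\chi_1,\chi_2}(n,s)=\sum_{ab=n}\chi_1(a)\overline{\chi_2}(b)\Big(\frac ba\Big)^{s-\frac12},$$ and define $F_{\chi_1',\chi_2'}$ in the same way. For $\gamma\in\Gamma_0(N)$ let $$\phi_{\chi_1,\chi_2}(\gamma,z)=F_{\chi_1,\chi_2}(\gamma z)-\psi(\gamma)F_{\chi_1,\chi_2}(z),$$ and likewise $\phi_{\chi_1',\chi_2'}(\gamma,z)$ with $\psi'$ in place of $\psi$. *Atkin–Lehner operators.* Let $r_0,u_0\in\mathbb Z$ with $(r_0,R)=1$ and $(u_0,Q)=1$. An Atkin–Lehner operator with data $(r_0,u_0)$ is a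 matrix $$W_Q=\begin{pmatrix}Qr&t\\Nu&Qv\end{pmatrix},\qquad r,t,u,v\in\mathbb Z,\quad r\equiv r_0\ (\mathrm{mod}\ R),\quad u\equiv u_0\ (\mathrm{mod}\ Q),\quad Qrv-Rut=1.$$ Put $$C=\chi_1^{(Q)}(-1)\,\psi^{(Q)}(q_1^{(R)}u_0)\,\overline{\psi^{(R)}}(q_2^{(Q)}r_0),\qquad \beta=\frac{q_2\,\tau(\chi_2')}{q_2'\,\tau(\chi_2)}\,C,\qquad \xi=\frac{\tau(\overline{\chi_1})}{\tau(\overline{\chi_1'})}\,\beta,$$ and $\phi_{\chi_1,\chi_2}(W_Q,z)=F_{\chi_1,\chi_2}(W_Qz)-\beta F_{\chi_1',\chi_2'}(z)$. *Claim.* Let $W_Q,W_Q'$ be Atkin–Lehner operators with the same data $(r_0,u_0)$, and let $\gamma,\gamma'\in\Gamma_0(N)$ satisfy $W_Q\gamma=\gamma'W_Q'$. Then $\phi_{\chi_1,\chi_2}(W_Q,z)$, $\phi_{\chi_1,\chi_2}(W_Q',z)$, $\phi_{\chi_1',\chi_2'}(\gamma,z)$ and $\phi_{\chi_1,\chi_2}(\gamma',z)$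 do not depend on $z\in\mathbb H$. Dropping $z$ from the notation, define $$S_{\chi_1,\chi_2}(M)=\frac{\tau(\overline{\chi_1})}{\pi i}\,\phi_{\chi_1,\chi_2}(M)\quad(M=W_Q,\ W_Q',\ \gamma'),\qquad S_{\chi_1',\chi_2'}(\gamma)=\frac{\tau(\overline{\chi_1'})}{\pi i}\,\phi_{\chi_1',\chi_2'}(\gamma).$$ Then $$S_{\chi_1,\chi_2}(W_Q)+\xi\,S_{\chi_1',\chi_2'}(\gamma)=\psi'(\gamma)\,S_{\chi_1,\chi_2}(W_Q')+S_{\chi_1,\chi_2}(\gamma').$$ -/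

import Mathlib

open UpperHalfPlane hiding I
open scoped MatrixGroups

namespace NewformDedekind

noncomputable section

/-! ### Local parts of Dirichlet characters -/

theorem gcd_mul_gcd {q Q R : ℕ} (hQR : Q.Coprime R) (hq : q ∣ Q * R) :
    q.gcd Q * q.gcd R = q := by
  rw [← Nat.Coprime.gcd_mul q hQR]
  exact Nat.gcd_eq_left hq

instance gcd_neZero {q Q : ℕ} [NeZero q] : NeZero (q.gcd Q) :=
  ⟨(Nat.gcd_pos_of_pos_left Q (Nat.pos_of_ne_zero (NeZero.ne q))).ne'⟩

/-- The Chinese remainder isomorphism `ℤ/q ≃ ℤ/(q, Q) × ℤ/(q, R)` for `(Q, R) = 1`, `q ∣ QR`. -/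
def crt {q Q R : ℕ} (hQR : Q.Coprime R) (hq : q ∣ Q * R) :
    ZMod q ≃+* ZMod (q.gcd Q) × ZMod (q.gcd R) :=
  (ZMod.ringEquivCongr (gcd_mul_gcd hQR hq).symm).trans
    (ZMod.chineseRemainder (hQR.gcd_both q q))

/-- The map sending `x` modulo `(q, Q)` to the residue class modulo `q` which is `x` modulo
`(q, Q)` and `1` modulo `(q, R)`. -/
def crtInl {q Q R : ℕ} (hQR : Q.Coprime R) (hq : q ∣ Q * R) : ZMod (q.gcd Q) →* ZMod q :=
  (crt hQR hq).symm.toMonoidHom.comp (MonoidHom.inl (ZMod (q.gcd Q)) (ZMod (q.gcd R)))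

theorem crt_apply {q Q R : ℕ} (hQR : Q.Coprime R) (hq : q ∣ Q * R) (x : ZMod q) :
    crt hQR hq x = (ZMod.castHom (Nat.gcd_dvd_left q Q) _ x,
      ZMod.castHom (Nat.gcd_dvd_left q R) _ x) := by
  have h1 : (RingHom.fst _ _).comp (crt hQR hq).toRingHom =
    ZMod.castHom (Nat.gcd_dvd_left q Q) (ZMod (q.gcd Q)) := Subsingleton.elim _ _
  have h2 : (RingHom.snd _ _).comp (crt hQR hq).toRingHom =
    ZMod.castHom (Nat.gcd_dvd_left q R) (ZMod (q.gcd R)) := Subsingleton.elim _ _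
  exact Prod.ext (congrArg (fun f => f x) h1) (congrArg (fun f => f x) h2)

theorem crtInl_mul_crtInl {q Q R : ℕ} (hQR : Q.Coprime R) (hq : q ∣ Q * R)
    (hq' : q ∣ R * Q) (x : ZMod q) :
    crtInl hQR hq (ZMod.castHom (Nat.gcd_dvd_left q Q) _ x) *
      crtInl hQR.symm hq' (ZMod.castHom (Nat.gcd_dvd_left q R) _ x) = x := by
  have h1 := (crt hQR hq).apply_symm_apply
    (ZMod.castHom (Nat.gcd_dvd_left q Q) (ZMod (q.gcd Q)) x, 1)
  have h2 := (crt hQR.symm hq').apply_symm_apply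
    (ZMod.castHom (Nat.gcd_dvd_left q R) (ZMod (q.gcd R)) x, 1)
  change crt hQR hq (crtInl hQR hq _) = _ at h1
  change crt hQR.symm hq' (crtInl hQR.symm hq' _) = _ at h2
  rw [crt_apply, Prod.mk.injEq] at h1 h2
  apply (crt hQR hq).injective
  rw [crt_apply, crt_apply, map_mul, map_mul, h1.1, h1.2, h2.1, h2.2, mul_one, one_mul]

/-- The `Q`-part `χ^(Q)`, a character modulo `(q, Q)`, of a Dirichlet character `χ` modulo `q`,
where `(Q, R) = 1` and `q ∣ QR`. The `R`-part is obtained by exchanging `Q` and `R`. -/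
def localPart {q Q R : ℕ} (hQR : Q.Coprime R) (hq : q ∣ Q * R) (χ : DirichletCharacter ℂ q) :
    DirichletCharacter ℂ (q.gcd Q) :=
  MulChar.ofUnitHom (χ.toUnitHom.comp (Units.map (crtInl hQR hq)))

/-- The two local parts do factor the character: `χ = χ^(Q) χ^(R)`. -/
theorem localPart_mul_localPart {q Q R : ℕ} (hQR : Q.Coprime R) (hq : q ∣ Q * R)
    (χ : DirichletCharacter ℂ q) :
    χ = DirichletCharacter.changeLevel (Nat.gcd_dvd_left q Q) (localPart hQR hq χ) *
      DirichletCharacter.changeLevel (Nat.gcd_dvd_left q R)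
        (localPart hQR.symm (mul_comm Q R ▸ hq) χ) := by
  refine MulChar.ext fun a => ?_
  rw [MulChar.mul_apply, DirichletCharacter.changeLevel_eq_cast_of_dvd,
    DirichletCharacter.changeLevel_eq_cast_of_dvd]
  have e1 : ((a : ZMod q).cast : ZMod (q.gcd Q)) =
      (Units.map (ZMod.castHom (Nat.gcd_dvd_left q Q) (ZMod (q.gcd Q))).toMonoidHom a :
        ZMod (q.gcd Q)) := rfl
  have e2 : ((a : ZMod q).cast : ZMod (q.gcd R)) =
      (Units.map (ZMod.castHom (Nat.gcd_dvd_left q R) (ZMod (q.gcd R))).toMonoidHom a :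
        ZMod (q.gcd R)) := rfl
  rw [e1, e2, localPart, localPart, MulChar.ofUnitHom_coe, MulChar.ofUnitHom_coe]
  simp only [MonoidHom.comp_apply, MulChar.coe_toUnitHom]
  rw [← map_mul]
  exact congrArg χ (crtInl_mul_crtInl hQR hq (mul_comm Q R ▸ hq) a).symm

/-- `ψ = χ₁ \overline{χ₂}`, a character modulo `q₁ q₂`. -/
def nebentypus {q₁ q₂ : ℕ} (χ₁ : DirichletCharacter ℂ q₁) (χ₂ : DirichletCharacter ℂ q₂) :
    DirichletCharacter ℂ (q₁ * q₂) :=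
  DirichletCharacter.changeLevel (dvd_mul_right q₁ q₂) χ₁ *
    DirichletCharacter.changeLevel (dvd_mul_left q₂ q₁) χ₂⁻¹

/-- A character modulo `N` as a function of a matrix: `ψ(γ) = ψ(d)`, `d` the lower right entry. -/
def charMat {N : ℕ} (ψ : DirichletCharacter ℂ N) (γ : SL(2, ℤ)) : ℂ :=
  ψ ((γ 1 1 : ℤ) : ZMod N)

section Swap

variable {q₁ q₂ Q R : ℕ}

theorem dvd_fst (hN : q₁ * q₂ = Q * R) : q₁ ∣ Q * R := hN ▸ dvd_mul_right q₁ q₂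

theorem dvd_snd (hN : q₁ * q₂ = Q * R) : q₂ ∣ Q * R := hN ▸ dvd_mul_left q₂ q₁

/-- `χ₁' = χ₂^(Q) χ₁^(R)`, a character modulo `q₁' = (q₂, Q) (q₁, R)`. -/
def swapFst (hQR : Q.Coprime R) (hN : q₁ * q₂ = Q * R)
    (χ₁ : DirichletCharacter ℂ q₁) (χ₂ : DirichletCharacter ℂ q₂) :
    DirichletCharacter ℂ (q₂.gcd Q * q₁.gcd R) :=
  DirichletCharacter.changeLevel (dvd_mul_right _ _) (localPart hQR (dvd_snd hN) χ₂) *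
    DirichletCharacter.changeLevel (dvd_mul_left _ _)
      (localPart hQR.symm (mul_comm Q R ▸ dvd_fst hN) χ₁)

/-- `χ₂' = χ₁^(Q) χ₂^(R)`, a character modulo `q₂' = (q₁, Q) (q₂, R)`. -/
def swapSnd (hQR : Q.Coprime R) (hN : q₁ * q₂ = Q * R)
    (χ₁ : DirichletCharacter ℂ q₁) (χ₂ : DirichletCharacter ℂ q₂) :
    DirichletCharacter ℂ (q₁.gcd Q * q₂.gcd R) :=
  DirichletCharacter.changeLevel (dvd_mul_right _ _) (localPart hQR (dvd_fst hN) χ₁) *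
    DirichletCharacter.changeLevel (dvd_mul_left _ _)
      (localPart hQR.symm (mul_comm Q R ▸ dvd_snd hN) χ₂)

end Swap

/-! ### The function `F` and newform Dedekind sums -/

/-- The Gauss sum `τ(χ) = ∑_{n mod q} χ(n) e(n / q)`. -/
def tau {q : ℕ} [NeZero q] (χ : DirichletCharacter ℂ q) : ℂ :=
  gaussSum χ (ZMod.stdAddChar (N := q))

section F

variable {q₁ q₂ : ℕ} [NeZero q₁] [NeZero q₂]

/-- `λ_{χ₁,χ₂}(n, s) = ∑_{ab = n} χ₁(a) \overline{χ₂}(b) (b / a)^{s - 1/2}` for `n ≥ 1`. -/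
def eisCoeff (χ₁ : DirichletCharacter ℂ q₁) (χ₂ : DirichletCharacter ℂ q₂) (n : ℕ) (s : ℂ) : ℂ :=
  ∑ p ∈ n.divisorsAntidiagonal,
    χ₁ (p.1 : ZMod q₁) * χ₂⁻¹ (p.2 : ZMod q₂) * ((p.2 : ℂ) / (p.1 : ℂ)) ^ (s - 1 / 2)

/-- The coefficient of `z` in `F`: it is `q₂² L(2, χ₂) / (2πi τ(χ₂))` if `q₁ = 1`, else `0`. -/
def linCoeff (χ₂ : DirichletCharacter ℂ q₂) (q₁ : ℕ) : ℂ :=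
  if q₁ = 1 then (q₂ : ℂ) ^ 2 * χ₂.LFunction 2 / (2 * Real.pi * Complex.I * tau χ₂) else 0

/-- The constant coefficient of `F`: it is `L(1, χ₁) / 2` if `q₂ = 1`, else `0`. -/
def constCoeff (χ₁ : DirichletCharacter ℂ q₁) (q₂ : ℕ) : ℂ :=
  if q₂ = 1 then 1 / 2 * χ₁.LFunction 1 else 0

/-- The holomorphic part `F_{χ₁,χ₂}` of the completed newform Eisenstein series at `s = 1`. -/
def eisF (χ₁ : DirichletCharacter ℂ q₁) (χ₂ : DirichletCharacter ℂ q₂) (z : ℍ) : ℂ :=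
  linCoeff χ₂ q₁ * (z : ℂ) + constCoeff χ₁ q₂ +
    ∑' n : ℕ+, eisCoeff χ₁ χ₂ n 1 / (Real.sqrt (n : ℕ) : ℂ) *
      Complex.exp (2 * Real.pi * Complex.I * ((n : ℕ) : ℂ) * (z : ℂ))

/-- `φ_{χ₁,χ₂}(γ, z) = F(γ z) - ψ(γ) F(z)`. -/
def phi (χ₁ : DirichletCharacter ℂ q₁) (χ₂ : DirichletCharacter ℂ q₂) (γ : SL(2, ℤ)) (z : ℍ) : ℂ :=
  eisF χ₁ χ₂ (γ • z) - charMat (nebentypus χ₁ χ₂) γ * eisF χ₁ χ₂ z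

/-- The newform Dedekind sum `S_{χ₁,χ₂}(γ) = τ(\overline{χ₁}) / (πi) · φ_{χ₁,χ₂}(γ)`, where
`φ_{χ₁,χ₂}(γ)` is the constant value of `φ_{χ₁,χ₂}(γ, ·)`, here taken at the point `i`. -/
def dedekindSum (χ₁ : DirichletCharacter ℂ q₁) (χ₂ : DirichletCharacter ℂ q₂)
    (γ : SL(2, ℤ)) : ℂ :=
  tau χ₁⁻¹ / (Real.pi * Complex.I) * phi χ₁ χ₂ γ UpperHalfPlane.I

end F

/-! ### Atkin–Lehner operators -/

/-- The Atkin–Lehner operators `W_Q^{(r₀, u₀)}` on `Γ₀(N)`, `N = QR`. -/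
structure AtkinLehner (Q R : ℕ) (r₀ u₀ : ℤ) where
  (r t u v : ℤ)
  r_modEq : r ≡ r₀ [ZMOD R]
  u_modEq : u ≡ u₀ [ZMOD Q]
  det_eq : Q * r * v - R * u * t = 1

namespace AtkinLehner

variable {Q R : ℕ} {r₀ u₀ : ℤ}

/-- The matrix `(Qr, t; Nu, Qv)` with `N = QR`. -/
def mat (W : AtkinLehner Q R r₀ u₀) : Matrix (Fin 2) (Fin 2) ℤ :=
  !![Q * W.r, W.t; Q * R * W.u, Q * W.v]

theorem det_mat (W : AtkinLehner Q R r₀ u₀) : W.mat.det = Q := by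
  rw [mat, Matrix.det_fin_two_of]
  linear_combination (Q : ℤ) * W.det_eq

/-- The same matrix in `GL₂(ℝ)`, acting on the upper half plane by Möbius transformations. -/
def toGL [NeZero Q] (W : AtkinLehner Q R r₀ u₀) : GL (Fin 2) ℝ :=
  Matrix.GeneralLinearGroup.mkOfDetNeZero (W.mat.map (Int.cast : ℤ → ℝ)) (by
    have h : (W.mat.map (Int.cast : ℤ → ℝ)).det = ((W.mat.det : ℤ) : ℝ) :=
      ((Int.castRingHom ℝ).map_det W.mat).symm
    rw [h, W.det_mat]
    exact_mod_cast NeZero.ne Q)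

end AtkinLehner

section AL

variable {q₁ q₂ Q R : ℕ} [NeZero q₁] [NeZero q₂] [NeZero Q]

/-- The pseudo-eigenvalue
`C = χ₁^(Q)(-1) ψ^(Q)(q₁^(R) u₀) \overline{ψ}^(R)(q₂^(Q) r₀)`, with `ψ = χ₁ \overline{χ₂}`. -/
def pseudoC (hQR : Q.Coprime R) (hN : q₁ * q₂ = Q * R)
    (χ₁ : DirichletCharacter ℂ q₁) (χ₂ : DirichletCharacter ℂ q₂) (r₀ u₀ : ℤ) : ℂ :=
  localPart hQR (dvd_fst hN) χ₁ (-1) *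
    localPart hQR hN.dvd (nebentypus χ₁ χ₂) (((q₁.gcd R : ℕ) * u₀ : ℤ) : ZMod _) *
    (localPart hQR.symm (mul_comm Q R ▸ hN.dvd) (nebentypus χ₁ χ₂))⁻¹
      (((q₂.gcd Q : ℕ) * r₀ : ℤ) : ZMod _)

/-- `β = q₂ τ(χ₂') / (q₂' τ(χ₂)) · C`. -/
def beta (hQR : Q.Coprime R) (hN : q₁ * q₂ = Q * R)
    (χ₁ : DirichletCharacter ℂ q₁) (χ₂ : DirichletCharacter ℂ q₂) (r₀ u₀ : ℤ) : ℂ :=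
  (q₂ : ℂ) * tau (swapSnd hQR hN χ₁ χ₂) / (((q₁.gcd Q * q₂.gcd R : ℕ) : ℂ) * tau χ₂) *
    pseudoC hQR hN χ₁ χ₂ r₀ u₀

/-- `φ_{χ₁,χ₂}(W_Q, z) = F_{χ₁,χ₂}(W_Q z) - β F_{χ₁',χ₂'}(z)`. -/
def phiAL (hQR : Q.Coprime R) (hN : q₁ * q₂ = Q * R)
    (χ₁ : DirichletCharacter ℂ q₁) (χ₂ : DirichletCharacter ℂ q₂) {r₀ u₀ : ℤ}
    (W : AtkinLehner Q R r₀ u₀) (z : ℍ) : ℂ :=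
  eisF χ₁ χ₂ (W.toGL • z) -
    beta hQR hN χ₁ χ₂ r₀ u₀ * eisF (swapFst hQR hN χ₁ χ₂) (swapSnd hQR hN χ₁ χ₂) z

/-- `S_{χ₁,χ₂}(W_Q) = τ(\overline{χ₁}) / (πi) · φ_{χ₁,χ₂}(W_Q)`, where `φ_{χ₁,χ₂}(W_Q)` is the
constant value of `φ_{χ₁,χ₂}(W_Q, ·)`, here taken at the point `i`. -/
def dedekindSumAL (hQR : Q.Coprime R) (hN : q₁ * q₂ = Q * R)
    (χ₁ : DirichletCharacter ℂ q₁) (χ₂ : DirichletCharacter ℂ q₂) {r₀ u₀ : ℤ}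
    (W : AtkinLehner Q R r₀ u₀) : ℂ :=
  tau χ₁⁻¹ / (Real.pi * Complex.I) * phiAL hQR hN χ₁ χ₂ W UpperHalfPlane.I

/-- The constant `ξ = τ(\overline{χ₁}) β / τ(\overline{χ₁'})`. -/
def xi (hQR : Q.Coprime R) (hN : q₁ * q₂ = Q * R)
    (χ₁ : DirichletCharacter ℂ q₁) (χ₂ : DirichletCharacter ℂ q₂) (r₀ u₀ : ℤ) : ℂ :=
  tau χ₁⁻¹ * beta hQR hN χ₁ χ₂ r₀ u₀ / tau (swapFst hQR hN χ₁ χ₂)⁻¹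

end AL

end

end NewformDedekind

namespace NewformDedekind

noncomputable section

/-! ### Weighted sums of division values of the Weierstrass function -/

/-! The derivative of F is a weight two Eisenstein series, whose lattice sum is not absolutely
convergent. The Weierstrass function ℘ gets around this: up to an explicit constant, F'(z) is the
sum of ℘ over the N-division points of ℤq₂z + ℤ with weights χ₁(x)χ₂(y) (`divSum_prodChar`). Since
q₁q₂ > 1 the weights sum to zero, so the corrections 1/ℓ² in ℘ cancel and the series can be summed
by rows; the Lipschitz formula and Gauss sums turn each row into exponentials.

As ℘ depends only on the lattice and is homogeneous of degree -2, a unimodular change of basis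
merely permutes division points (`divSum_coordEquiv`). Modularity is thereby reduced to an identity
between character values, which is where ψ and C arise (`eisDeriv_transform`,
`prodChar_atkinLehner`). Hence F(γz) - ψ(γ)F(z) and F(W_Q z) - βF_{χ₁',χ₂'}(z) have zero derivative
and are constant (`phi_const`, `phiAL_const`).

For reciprocity, expand F at the single point W_Q γ i = γ' W_Q' i in both ways. The terms in
F_{χ₁',χ₂'}(i) carry the factors βψ'(γ) and βψ(γ'); they cancel because ψ(γ') = ψ'(γ)
(`charMat_swap_eq`), and the four constants that remain are the Dedekind sums. -/

/-- The lattice point with coordinates `l` with respect to `(ω₁, ω₂)`. -/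
def latPt (ω₁ ω₂ : ℂ) (l : ℤ × ℤ) : ℂ := l.1 * ω₁ + l.2 * ω₂

/-- The Weierstrass function of the lattice `ℤω₁ + ℤω₂` as a sum over coordinates. -/
def latSum (ω₁ ω₂ w : ℂ) : ℂ :=
  ∑' l : ℤ × ℤ, (1 / (w - latPt ω₁ ω₂ l) ^ 2 - 1 / latPt ω₁ ω₂ l ^ 2)

theorem hasSum_weierstrassP_coords (L : PeriodPair) (w : ℂ) :
    HasSum (fun l : ℤ × ℤ => 1 / (w - latPt L.ω₁ L.ω₂ l) ^ 2 - 1 / latPt L.ω₁ L.ω₂ l ^ 2)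
      (L.weierstrassP w) := by
  have h := (L.latticeEquivProd.symm.toEquiv.hasSum_iff).2 (L.hasSum_weierstrassP w)
  refine h.congr_fun ?_
  intro l
  have e : ((L.latticeEquivProd.symm.toEquiv l : L.lattice) : ℂ) = latPt L.ω₁ L.ω₂ l :=
    L.latticeEquiv_symm_apply l
  simp only [Function.comp_apply, e]

theorem latSum_eq_weierstrassP (L : PeriodPair) (w : ℂ) :
    latSum L.ω₁ L.ω₂ w = L.weierstrassP w :=
  (hasSum_weierstrassP_coords L w).tsum_eq

theorem latSum_add_latPt (L : PeriodPair) (w : ℂ) (l : ℤ × ℤ) :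
    latSum L.ω₁ L.ω₂ (w + latPt L.ω₁ L.ω₂ l) = latSum L.ω₁ L.ω₂ w := by
  rw [latSum_eq_weierstrassP, latSum_eq_weierstrassP]
  exact L.weierstrassP_add_coe w ⟨_, PeriodPair.mem_lattice.2 ⟨l.1, l.2, rfl⟩⟩

/-- Homogeneity of the Weierstrass function. -/
theorem latSum_mul (k ω₁ ω₂ w : ℂ) :
    latSum (k * ω₁) (k * ω₂) (k * w) = (k ^ 2)⁻¹ * latSum ω₁ ω₂ w := by
  rw [latSum, latSum, ← tsum_mul_left]
  refine tsum_congr fun l => ?_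
  have e : latPt (k * ω₁) (k * ω₂) l = k * latPt ω₁ ω₂ l := by simp only [latPt]; ring
  rw [e, ← mul_sub, mul_pow, mul_pow, mul_sub]
  simp only [one_div, mul_inv]

/-- The coordinate change given by an integral matrix of determinant one. -/
def coordEquiv {A : Type*} [CommRing A] (a b c d : A) (h : a * d - b * c = 1) : A × A ≃ A × A where
  toFun p := (p.1 * a + p.2 * c, p.1 * b + p.2 * d)
  invFun p := (p.1 * d - p.2 * c, p.2 * a - p.1 * b)
  left_inv p := by
    ext
    · simp only; linear_combination p.1 * h
    · simp only; linear_combination p.2 * h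
  right_inv p := by
    ext
    · simp only; linear_combination p.1 * h
    · simp only; linear_combination p.2 * h

/-- The Weierstrass function depends only on the lattice. -/
theorem latSum_coordEquiv (a b c d : ℤ) (h : a * d - b * c = 1) (ω₁ ω₂ w : ℂ) :
    latSum (a * ω₁ + b * ω₂) (c * ω₁ + d * ω₂) w = latSum ω₁ ω₂ w := by
  rw [latSum, latSum, ← (coordEquiv a b c d h).tsum_eq
    fun l => 1 / (w - latPt ω₁ ω₂ l) ^ 2 - 1 / latPt ω₁ ω₂ l ^ 2]
  refine tsum_congr fun l => ?_
  have e : latPt (a * ω₁ + b * ω₂) (c * ω₁ + d * ω₂) l =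
      latPt ω₁ ω₂ (coordEquiv a b c d h l) := by
    simp only [latPt, coordEquiv, Equiv.coe_fn_mk]; push_cast; ring
  rw [e]

/-- The point of order dividing `N` with coordinates `v / N`. -/
def divPt (N : ℕ) (ω₁ ω₂ : ℂ) (v : ℤ × ℤ) : ℂ := latPt ω₁ ω₂ v / N

/-- The sum of the values of the Weierstrass function at the `N`-division points,
with weights `f`. -/
def divSum (N : ℕ) [NeZero N] (ω₁ ω₂ : ℂ) (f : ZMod N × ZMod N → ℂ) : ℂ :=
  ∑ v : ZMod N × ZMod N, f v * latSum ω₁ ω₂ (divPt N ω₁ ω₂ (v.1.val, v.2.val))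

/-- Periodicity of ℘. It frees the computation from the representatives `ZMod.val` chosen in
`divSum`. -/
theorem latSum_divPt_congr {N : ℕ} [NeZero N] (L : PeriodPair) {v w : ℤ × ℤ}
    (h₁ : (v.1 : ZMod N) = w.1) (h₂ : (v.2 : ZMod N) = w.2) :
    latSum L.ω₁ L.ω₂ (divPt N L.ω₁ L.ω₂ v) = latSum L.ω₁ L.ω₂ (divPt N L.ω₁ L.ω₂ w) := by
  obtain ⟨k₁, hk₁⟩ := (ZMod.intCast_eq_intCast_iff_dvd_sub _ _ _).1 h₁
  obtain ⟨k₂, hk₂⟩ := (ZMod.intCast_eq_intCast_iff_dvd_sub _ _ _).1 h₂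
  rw [← latSum_add_latPt L _ (k₁, k₂)]
  congr 1
  have hN : (N : ℂ) ≠ 0 := Nat.cast_ne_zero.2 (NeZero.ne N)
  have e₁ : (w.1 : ℂ) = v.1 + N * k₁ := by
    have : w.1 = v.1 + N * k₁ := by linarith
    rw [this]; push_cast; ring
  have e₂ : (w.2 : ℂ) = v.2 + N * k₂ := by
    have : w.2 = v.2 + N * k₂ := by linarith
    rw [this]; push_cast; ring
  simp only [divPt, latPt, e₁, e₂]
  field_simp
  ring

/-- Degree -2 homogeneity of ℘; the weight two automorphy factor comes from here. -/
theorem divSum_mul (N : ℕ) [NeZero N] (k ω₁ ω₂ : ℂ) (f : ZMod N × ZMod N → ℂ) :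
    divSum N (k * ω₁) (k * ω₂) f = (k ^ 2)⁻¹ * divSum N ω₁ ω₂ f := by
  rw [divSum, divSum, Finset.mul_sum]
  refine Finset.sum_congr rfl fun v _ => ?_
  have e : divPt N (k * ω₁) (k * ω₂) (v.1.val, v.2.val) =
      k * divPt N ω₁ ω₂ (v.1.val, v.2.val) := by
    simp only [divPt, latPt]; ring
  rw [e, latSum_mul]
  ring

theorem divSum_const_mul (N : ℕ) [NeZero N] (κ ω₁ ω₂ : ℂ) (f : ZMod N × ZMod N → ℂ) :
    divSum N ω₁ ω₂ (fun v => κ * f v) = κ * divSum N ω₁ ω₂ f := by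
  simp only [divSum, Finset.mul_sum, mul_assoc]

/-- Modular invariance of weighted sums of division values. -/
theorem divSum_coordEquiv {N : ℕ} [NeZero N] (L : PeriodPair) (a b c d : ℤ)
    (h : a * d - b * c = 1) (f g : ZMod N × ZMod N → ℂ)
    (hfg : ∀ x y : ℤ, f ((x : ZMod N), (y : ZMod N)) =
      g (((x * a + y * c : ℤ) : ZMod N), ((x * b + y * d : ℤ) : ZMod N))) :
    divSum N (a * L.ω₁ + b * L.ω₂) (c * L.ω₁ + d * L.ω₂) f = divSum N L.ω₁ L.ω₂ g := by
  -- The matrix remains unimodular modulo N, so it permutes (ℤ/N)² and can reindex the sum.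
  have h' : (a : ZMod N) * d - b * c = 1 := by exact_mod_cast congrArg (Int.cast : ℤ → ZMod N) h
  rw [divSum, divSum, ← (coordEquiv (a : ZMod N) b c d h').sum_comp
    fun v => g v * latSum L.ω₁ L.ω₂ (divPt N L.ω₁ L.ω₂ (v.1.val, v.2.val))]
  refine Finset.sum_congr rfl fun v _ => ?_
  have hv : f v = g (coordEquiv (a : ZMod N) b c d h' v) := by
    have := hfg v.1.val v.2.val
    simpa [coordEquiv] using this
  rw [hv, latSum_coordEquiv a b c d h]
  congr 1
  rw [← latSum_divPt_congr (N := N) L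
    (v := (v.1.val * a + v.2.val * c, v.1.val * b + v.2.val * d))]
  · congr 1
    simp only [divPt, latPt]; push_cast; ring
  · simp [coordEquiv]
  · simp [coordEquiv]

/-! ### Summation by rows -/

/-- Integers as pairs of a quotient and a residue class. -/
def intEquivProdZMod (N : ℕ) [NeZero N] : ℤ × ZMod N ≃ ℤ where
  toFun p := p.2.val + N * p.1
  invFun d := (d / N, (d : ZMod N))
  left_inv p := by
    have hN : (N : ℤ) ≠ 0 := Nat.cast_ne_zero.2 (NeZero.ne N)
    ext
    · simp only
      rw [Int.add_mul_ediv_left _ _ hN, Int.ediv_eq_zero_of_lt (by positivity)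
        (by exact_mod_cast p.2.val_lt), zero_add]
    · simp
  right_inv d := by
    simp only [ZMod.val_intCast]
    exact Int.emod_add_mul_ediv d N

theorem tsum_sum_zmod {N : ℕ} [NeZero N] {F : ℤ → ℂ} (hF : Summable F) :
    ∑' l : ℤ, ∑ v : ZMod N, F (v.val + N * l) = ∑' d : ℤ, F d := by
  have hs : Summable (fun p => F (intEquivProdZMod N p)) :=
    (intEquivProdZMod N).summable_iff.2 hF
  rw [← (intEquivProdZMod N).tsum_eq F, hs.tsum_prod]
  refine tsum_congr fun l => ?_
  rw [tsum_fintype]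
  rfl

/-- The correction terms of ℘ do not depend on v, so zero total weight removes them. The finite sum
over v must stay inside: the separate lattice sums of inverse squares are not absolutely convergent.
-/
theorem hasSum_divSum {N : ℕ} [NeZero N] (L : PeriodPair) (f : ZMod N × ZMod N → ℂ)
    (hf : ∑ v, f v = 0) :
    HasSum (fun l : ℤ × ℤ => ∑ v : ZMod N × ZMod N,
      f v * ((N : ℂ) ^ 2 / latPt L.ω₁ L.ω₂ (v.1.val + N * l.1, v.2.val + N * l.2) ^ 2))
      (divSum N L.ω₁ L.ω₂ f) := by
  have hN : (N : ℂ) ≠ 0 := Nat.cast_ne_zero.2 (NeZero.ne N)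
  have h : HasSum (fun l : ℤ × ℤ => ∑ v : ZMod N × ZMod N, f v *
      (1 / (divPt N L.ω₁ L.ω₂ (v.1.val, v.2.val) - latPt L.ω₁ L.ω₂ l) ^ 2 -
        1 / latPt L.ω₁ L.ω₂ l ^ 2)) (divSum N L.ω₁ L.ω₂ f) := by
    refine hasSum_sum fun v _ => HasSum.mul_left _ ?_
    rw [latSum_eq_weierstrassP]
    exact hasSum_weierstrassP_coords L _
  -- ℘ involves w - ℓ; replacing ℓ by -ℓ gives the points (v + Nℓ)/N.
  rw [← (Equiv.neg (ℤ × ℤ)).hasSum_iff] at h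
  refine h.congr_fun ?_
  intro l
  simp only [Function.comp_apply, Equiv.neg_apply, mul_sub, Finset.sum_sub_distrib]
  rw [← Finset.sum_mul, hf, zero_mul, sub_zero]
  refine Finset.sum_congr rfl fun v _ => ?_
  congr 1
  have e : divPt N L.ω₁ L.ω₂ (v.1.val, v.2.val) - latPt L.ω₁ L.ω₂ (-l) =
      latPt L.ω₁ L.ω₂ (v.1.val + N * l.1, v.2.val + N * l.2) / N := by
    simp only [divPt, latPt, Prod.fst_neg, Prod.snd_neg]
    push_cast
    field_simp
    ring
  rw [e, div_pow, one_div_div]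

/-- Fubini for the grouped series: each row converges absolutely, so v₂ and l₂ merge into d, and
then v₁ and l₁ into c. Convergence over c has to be assumed, since the grouped series only controls
blocks of N consecutive rows. -/
theorem divSum_eq_tsum_rows {N : ℕ} [NeZero N] (L : PeriodPair) (g h : ZMod N → ℂ)
    (hgh : (∑ v, g v) * (∑ v, h v) = 0)
    (hrow : ∀ c : ℤ, Summable fun d : ℤ => h d / latPt L.ω₁ L.ω₂ (c, d) ^ 2)
    (hsum : Summable fun c : ℤ => g c * ∑' d : ℤ, h d / latPt L.ω₁ L.ω₂ (c, d) ^ 2) :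
    divSum N L.ω₁ L.ω₂ (fun v => g v.1 * h v.2) =
      (N : ℂ) ^ 2 * ∑' c : ℤ, g c * ∑' d : ℤ, h d / latPt L.ω₁ L.ω₂ (c, d) ^ 2 := by
  have H := hasSum_divSum L (fun v => g v.1 * h v.2) (by
    rw [Fintype.sum_prod_type]; simpa only [Finset.sum_mul_sum] using hgh)
  rw [← H.tsum_eq, H.summable.tsum_prod, ← tsum_sum_zmod (N := N) hsum, ← tsum_mul_left]
  refine tsum_congr fun l₁ => ?_
  simp only [Fintype.sum_prod_type]
  have hs : ∀ v₁ : ZMod N, Summable fun l₂ : ℤ => ∑ v₂ : ZMod N, g v₁ * h v₂ *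
      ((N : ℂ) ^ 2 / latPt L.ω₁ L.ω₂ (v₁.val + N * l₁, v₂.val + N * l₂) ^ 2) := by
    intro v₁
    refine summable_sum fun v₂ _ => ?_
    have := (hrow (v₁.val + N * l₁)).comp_injective (i := fun l₂ : ℤ => (v₂.val + N * l₂ : ℤ)) (by
      intro x y hxy
      simpa [NeZero.ne N] using hxy)
    refine (this.mul_left (g v₁ * (N : ℂ) ^ 2)).congr fun l₂ => ?_
    simp
    ring
  rw [Summable.tsum_finsetSum fun v₁ _ => hs v₁, Finset.mul_sum]
  refine Finset.sum_congr rfl fun v₁ _ => ?_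
  rw [← tsum_sum_zmod (N := N) (hrow _), ← tsum_mul_left, ← tsum_mul_left]
  refine tsum_congr fun l₂ => ?_
  rw [Finset.mul_sum, Finset.mul_sum]
  refine Finset.sum_congr rfl fun v₂ _ => ?_
  simp
  ring

/-! ### The Fourier expansion of `F` and of its derivative -/

/-- At s = 1 the normalisation of `eisCoeff` thus reduces to 1/a; differentiating e(abz) then leaves
the weight b. -/
theorem sqrt_div_sqrt_mul (a b : ℕ+) :
    ((b : ℂ) / (a : ℂ)) ^ ((1 : ℂ) - 1 / 2) / (Real.sqrt ((a * b : ℕ+) : ℕ) : ℂ) = 1 / (a : ℂ) := by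
  have ha : (0 : ℝ) < (a : ℕ) := by exact_mod_cast a.pos
  have hb : (0 : ℝ) < (b : ℕ) := by exact_mod_cast b.pos
  have e : ((b : ℂ) / (a : ℂ)) ^ ((1 : ℂ) - 1 / 2) = ((Real.sqrt ((b : ℕ) / (a : ℕ)) : ℝ) : ℂ) := by
    rw [Real.sqrt_eq_rpow, Complex.ofReal_cpow (by positivity)]
    push_cast
    norm_num
  rw [e, ← Complex.ofReal_div]
  have : Real.sqrt ((b : ℕ) / (a : ℕ)) / Real.sqrt ((a * b : ℕ+) : ℕ) = 1 / (a : ℕ) := by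
    rw [← Real.sqrt_div' _ (by positivity), PNat.mul_coe, Nat.cast_mul]
    rw [show ((b : ℕ) : ℝ) / (a : ℕ) / ((a : ℕ) * (b : ℕ)) = (1 / (a : ℕ)) ^ 2 by field_simp]
    exact Real.sqrt_sq (by positivity)
  rw [this]
  push_cast
  rfl

theorem norm_dirichlet_le_one {q : ℕ} (χ : DirichletCharacter ℂ q) (x : ZMod q) : ‖χ x‖ ≤ 1 :=
  DirichletCharacter.norm_le_one χ x

section

variable {q₁ q₂ : ℕ} (χ₁ : DirichletCharacter ℂ q₁) (χ₂ : DirichletCharacter ℂ q₂)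

/-- The function `χ₁(a) \overline{χ₂}(b)` on pairs of positive integers. -/
def pairCoeff (p : ℕ+ × ℕ+) : ℂ := χ₁ ((p.1 : ℕ) : ZMod q₁) * χ₂⁻¹ ((p.2 : ℕ) : ZMod q₂)

theorem norm_pairCoeff_le (p : ℕ+ × ℕ+) : ‖pairCoeff χ₁ χ₂ p‖ ≤ 1 := by
  rw [pairCoeff, norm_mul]
  exact mul_le_one₀ (norm_dirichlet_le_one _ _) (norm_nonneg _) (norm_dirichlet_le_one _ _)

/-- The exponential `e(abz)`. -/
def pairExp (p : ℕ+ × ℕ+) (z : ℂ) : ℂ :=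
  Complex.exp (2 * Real.pi * Complex.I * ((p.1 * p.2 : ℕ+) : ℕ) * z)

theorem norm_pairExp (p : ℕ+ × ℕ+) (z : ℂ) :
    ‖pairExp p z‖ = Real.exp (-2 * Real.pi * z.im) ^ ((p.1 : ℕ) * (p.2 : ℕ)) := by
  rw [pairExp, Complex.norm_exp, ← Real.exp_nat_mul]
  congr 1
  rw [show 2 * (Real.pi : ℂ) * Complex.I * (((p.1 * p.2 : ℕ+) : ℕ) : ℂ) * z =
    ((2 * Real.pi * (((p.1 * p.2 : ℕ+) : ℕ) : ℝ) : ℝ) : ℂ) * (Complex.I * z) by push_cast; ring,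
    Complex.re_ofReal_mul, Complex.I_mul_re]
  push_cast
  ring

theorem summable_real_pow_mul {r : ℝ} (h0 : 0 ≤ r) (h1 : r < 1) (k : ℕ) :
    Summable fun p : ℕ+ × ℕ+ => ((p.2 : ℕ) : ℝ) ^ k * r ^ ((p.1 : ℕ) * (p.2 : ℕ)) :=
  summable_prod_mul_pow k (by rwa [Real.norm_eq_abs, abs_of_nonneg h0])

theorem exp_neg_lt_one {y : ℝ} (hy : 0 < y) : Real.exp (-2 * Real.pi * y) < 1 := by
  rw [Real.exp_lt_one_iff]
  have := Real.pi_pos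
  nlinarith [mul_pos this hy]

theorem summable_eis_pairs {z : ℂ} (hz : 0 < z.im) :
    Summable fun p : ℕ+ × ℕ+ => pairCoeff χ₁ χ₂ p / (p.1 : ℕ) * pairExp p z := by
  refine Summable.of_norm_bounded
    (summable_real_pow_mul (Real.exp_nonneg _) (exp_neg_lt_one hz) 0) fun p => ?_
  rw [norm_mul, norm_pairExp, pow_zero, one_mul, norm_div, Complex.norm_natCast]
  refine mul_le_of_le_one_left (by positivity) ?_
  exact div_le_one_of_le₀ ((norm_pairCoeff_le _ _ _).trans
    (Nat.one_le_cast.2 p.1.pos)) (by positivity)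

theorem tsum_eisCoeff [NeZero q₁] [NeZero q₂] {z : ℂ} (hz : 0 < z.im) :
    ∑' n : ℕ+, eisCoeff χ₁ χ₂ n 1 / (Real.sqrt (n : ℕ) : ℂ) *
      Complex.exp (2 * Real.pi * Complex.I * ((n : ℕ) : ℂ) * z) =
    ∑' p : ℕ+ × ℕ+, pairCoeff χ₁ χ₂ p / (p.1 : ℕ) * pairExp p z := by
  have hs := (sigmaAntidiagonalEquivProd.summable_iff).2 (summable_eis_pairs χ₁ χ₂ hz)
  rw [← sigmaAntidiagonalEquivProd.tsum_eq]
  refine Eq.trans ?_ (Summable.tsum_sigma hs).symm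
  refine tsum_congr fun n => ?_
  rw [tsum_fintype, eisCoeff, ← Finset.sum_attach, Finset.sum_div, Finset.sum_mul]
  refine Finset.sum_congr rfl fun p _ => ?_
  have hn := divisorsAntidiagonalFactors_eq p
  have key := sqrt_div_sqrt_mul (divisorsAntidiagonalFactors n p).1
    (divisorsAntidiagonalFactors n p).2
  have e1 : (((divisorsAntidiagonalFactors n p).1 : ℕ+) : ℕ) = p.1.1 := rfl
  have e2 : (((divisorsAntidiagonalFactors n p).2 : ℕ+) : ℕ) = p.1.2 := rfl
  have hn' : (divisorsAntidiagonalFactors n p).1 * (divisorsAntidiagonalFactors n p).2 = n :=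
    PNat.coe_injective hn
  have hE : sigmaAntidiagonalEquivProd ⟨n, p⟩ = divisorsAntidiagonalFactors n p := rfl
  simp only [Function.comp_apply]
  rw [hE, pairExp, hn', pairCoeff, e1, e2]
  rw [hn', e1, e2] at key
  rw [mul_div_assoc, key, mul_one_div]

/-- The function `F` on the complex plane. -/
def eisFExt [NeZero q₁] [NeZero q₂] (z : ℂ) : ℂ := linCoeff χ₂ q₁ * z + constCoeff χ₁ q₂ +
  ∑' p : ℕ+ × ℕ+, pairCoeff χ₁ χ₂ p / (p.1 : ℕ) * pairExp p z

theorem eisF_eq_eisFExt [NeZero q₁] [NeZero q₂] (z : ℍ) : eisF χ₁ χ₂ z = eisFExt χ₁ χ₂ z := by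
  rw [eisF, eisFExt, tsum_eisCoeff χ₁ χ₂ z.2]

/-- The derivative of `F`, a weight two Eisenstein series. -/
def eisDeriv [NeZero q₁] [NeZero q₂] (z : ℂ) : ℂ := linCoeff χ₂ q₁ +
  2 * Real.pi * Complex.I * ∑' p : ℕ+ × ℕ+, pairCoeff χ₁ χ₂ p * (p.2 : ℕ) * pairExp p z

theorem hasDerivAt_pairExp (p : ℕ+ × ℕ+) (z : ℂ) :
    HasDerivAt (pairExp p)
      (2 * Real.pi * Complex.I * ((p.1 * p.2 : ℕ+) : ℕ) * pairExp p z) z := by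
  have h := ((hasDerivAt_id z).const_mul
    (2 * Real.pi * Complex.I * (((p.1 * p.2 : ℕ+) : ℕ) : ℂ))).cexp
  simp only [id, mul_one] at h
  rw [mul_comm]
  exact h

theorem hasDerivAt_eisFExt [NeZero q₁] [NeZero q₂] {z : ℂ} (hz : 0 < z.im) :
    HasDerivAt (eisFExt χ₁ χ₂) (eisDeriv χ₁ χ₂ z) z := by
  -- On the half-plane Im w > Im z / 2 the differentiated terms have one summable majorant, which
  -- justifies termwise differentiation.
  have hz2 : z.im / 2 < z.im := by linarith
  have H := hasDerivAt_tsum_of_isPreconnected (𝕜 := ℂ)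
    (g := fun p z => pairCoeff χ₁ χ₂ p / (p.1 : ℕ) * pairExp p z)
    (g' := fun p z => 2 * Real.pi * Complex.I *
      (pairCoeff χ₁ χ₂ p * (p.2 : ℕ) * pairExp p z))
    (t := {w : ℂ | z.im / 2 < w.im}) (y₀ := z) (y := z)
    ((summable_real_pow_mul (Real.exp_nonneg _)
      (exp_neg_lt_one (half_pos hz)) 1).mul_left (2 * Real.pi))
    (isOpen_lt continuous_const Complex.continuous_im)
    (convex_halfSpace_im_gt _).isPreconnected
    (fun p w _ => by
      refine ((hasDerivAt_pairExp p w).const_mul _).congr_deriv ?_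
      have : ((p.1 : ℕ) : ℂ) ≠ 0 := Nat.cast_ne_zero.2 p.1.ne_zero
      push_cast
      field_simp)
    (fun p w hw => by
      have e : ‖2 * (Real.pi : ℂ) * Complex.I‖ = 2 * Real.pi := by
        simp [abs_of_pos Real.pi_pos]
      rw [norm_mul, e, norm_mul, norm_mul, norm_pairExp, pow_one, Complex.norm_natCast]
      have h1 : z.im / 2 < w.im := hw
      have h2 : Real.exp (-2 * Real.pi * w.im) ≤ Real.exp (-2 * Real.pi * (z.im / 2)) :=
        Real.exp_le_exp.2 (by nlinarith [Real.pi_pos])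
      have h3 : ‖pairCoeff χ₁ χ₂ p‖ * ((p.2 : ℕ) : ℝ) ≤ (p.2 : ℕ) :=
        mul_le_of_le_one_left (by positivity) (norm_pairCoeff_le _ _ _)
      have h4 := pow_le_pow_left₀ (Real.exp_nonneg _) h2 ((p.1 : ℕ) * (p.2 : ℕ))
      have h5 := Real.pi_pos
      exact mul_le_mul_of_nonneg_left (mul_le_mul h3 h4 (by positivity) (by positivity))
        (by positivity))
    hz2 (summable_eis_pairs χ₁ χ₂ hz) hz2
  rw [tsum_mul_left] at H
  have h1 := (((hasDerivAt_id z).const_mul (linCoeff χ₂ q₁)).add_const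
    (constCoeff χ₁ q₂)).add H
  rw [mul_one] at h1
  exact h1

theorem summable_eisDeriv_pairs {z : ℂ} (hz : 0 < z.im) :
    Summable fun p : ℕ+ × ℕ+ => pairCoeff χ₁ χ₂ p * (p.2 : ℕ) * pairExp p z := by
  refine Summable.of_norm_bounded
    (summable_real_pow_mul (Real.exp_nonneg _) (exp_neg_lt_one hz) 1) fun p => ?_
  rw [norm_mul, norm_pairExp, pow_one, norm_mul, Complex.norm_natCast]
  gcongr
  exact mul_le_of_le_one_left (by positivity) (norm_pairCoeff_le _ _ _)

end

/-! ### Rows of the Eisenstein series -/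

/-- The discrete Fourier transform of a primitive χ is a multiple of τ(χ). It is injective and χ(1)
= 1, so τ(χ) cannot vanish. -/
theorem tau_ne_zero {q : ℕ} [NeZero q] {χ : DirichletCharacter ℂ q} (hχ : χ.IsPrimitive) :
    tau χ ≠ 0 := by
  intro h
  have h0 : ZMod.dft (χ : ZMod q → ℂ) = 0 := by
    funext k
    rw [hχ.fourierTransform_eq_inv_mul_gaussSum]
    exact mul_eq_zero_of_right _ h
  have h1 : (χ : ZMod q → ℂ) = 0 := (LinearEquiv.map_eq_zero_iff _).1 h0
  have h2 := congrFun h1 1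
  simp at h2

theorem sum_char_mul_exp {q : ℕ} [NeZero q] {χ : DirichletCharacter ℂ q} (hχ : χ.IsPrimitive)
    (n : ℕ) :
    ∑ v : ZMod q, χ v * Complex.exp (2 * Real.pi * Complex.I * n * ((v.val : ℂ) / q)) =
      χ⁻¹ (n : ZMod q) * tau χ := by
  rw [tau, ← gaussSum_mulShift_of_isPrimitive _ hχ, gaussSum]
  refine Finset.sum_congr rfl fun v _ => ?_
  rw [AddChar.mulShift_apply]
  have : (n : ZMod q) * v = ((n * v.val : ℤ) : ZMod q) := by simp
  rw [this, ZMod.stdAddChar_coe]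
  congr 2
  push_cast
  ring

theorem summable_char_div_sq {q : ℕ} [NeZero q] (χ : DirichletCharacter ℂ q) (w : ℂ) :
    Summable fun d : ℤ => χ (d : ZMod q) / (w + d) ^ 2 := by
  have h := (EisensteinSeries.linear_right_summable w 1 (k := 2) le_rfl).norm
  refine Summable.of_norm_bounded h fun d => ?_
  rw [div_eq_mul_inv, norm_mul]
  refine (mul_le_of_le_one_left (norm_nonneg _) (norm_dirichlet_le_one _ _)).trans_eq ?_
  simp

/-- The Lipschitz formula is applied in each residue class modulo q; summing the resulting phases
against χ produces the Gauss sum, for every n by primitivity. -/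
theorem tsum_char_div_sq {q : ℕ} [NeZero q] {χ : DirichletCharacter ℂ q} (hχ : χ.IsPrimitive)
    {w : ℂ} (hw : 0 < w.im) :
    ∑' d : ℤ, χ (d : ZMod q) / (w + d) ^ 2 = (2 * Real.pi * Complex.I / q) ^ 2 * tau χ *
      ∑' n : ℕ+, χ⁻¹ ((n : ℕ) : ZMod q) * (n : ℕ) *
        Complex.exp (2 * Real.pi * Complex.I * (n : ℕ) * (w / q)) := by
  have hq : (q : ℂ) ≠ 0 := Nat.cast_ne_zero.2 (NeZero.ne q)
  have hqpos : (0 : ℝ) < q := Nat.cast_pos.2 (Nat.pos_of_ne_zero (NeZero.ne q))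
  have him : ∀ v : ZMod q, 0 < ((w + v.val) / q).im := fun v => by
    rw [Complex.div_natCast_im, Complex.add_im, Complex.natCast_im, add_zero]
    exact div_pos hw hqpos
  rw [← tsum_sum_zmod (N := q) (summable_char_div_sq χ w)]
  have hterm : ∀ (l : ℤ) (v : ZMod q),
      χ (((v.val + q * l : ℤ)) : ZMod q) / (w + ((v.val + q * l : ℤ) : ℂ)) ^ 2 =
      χ v / q ^ 2 * (1 / ((w + v.val) / q + l) ^ 2) := by
    intro l v
    have : w + ((v.val + q * l : ℤ) : ℂ) = q * ((w + v.val) / q + l) := by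
      push_cast; field_simp; ring
    rw [this, mul_pow]
    simp only [Int.cast_add, Int.cast_natCast, Int.cast_mul, CharP.cast_eq_zero, zero_mul, add_zero,
      ZMod.natCast_zmod_val]
    field_simp
  simp only [hterm]
  rw [Summable.tsum_finsetSum]
  · have hq2 : ∀ v : ZMod q, ∑' l : ℤ, χ v / q ^ 2 * (1 / ((w + v.val) / q + l) ^ 2) =
        ∑' n : ℕ+, (2 * Real.pi * Complex.I / q) ^ 2 * ((n : ℕ) *
          Complex.exp (2 * Real.pi * Complex.I * (n : ℕ) * (w / q))) *
          (χ v * Complex.exp (2 * Real.pi * Complex.I * (n : ℕ) * ((v.val : ℂ) / q))) := by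
      intro v
      have h := EisensteinSeries.qExpansion_identity_pnat (k := 1) le_rfl ⟨_, him v⟩
      simp only [Nat.reduceAdd, pow_one, Nat.factorial_one,
        Nat.cast_one, div_one] at h
      rw [tsum_mul_left, h, ← tsum_mul_left, ← tsum_mul_left]
      refine tsum_congr fun n => ?_
      rw [← Complex.exp_nat_mul]
      have : Complex.exp ((n : ℕ) * (2 * Real.pi * Complex.I * ((w + v.val) / q))) =
          Complex.exp (2 * Real.pi * Complex.I * (n : ℕ) * (w / q)) *
          Complex.exp (2 * Real.pi * Complex.I * (n : ℕ) * ((v.val : ℂ) / q)) := by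
        rw [← Complex.exp_add]; congr 1; field_simp
      rw [this]
      field_simp
    simp only [hq2]
    rw [← Summable.tsum_finsetSum, ← tsum_mul_left]
    · refine tsum_congr fun n => ?_
      rw [← Finset.mul_sum, sum_char_mul_exp hχ]
      ring
    · intro v _
      have h := summable_pow_mul_cexp 1 1 ⟨_, him v⟩
      have h2 : Summable fun n : ℕ+ => _ := h.comp_injective PNat.coe_injective
      refine (h2.mul_left ((2 * Real.pi * Complex.I / q) ^ 2 * χ v)).congr fun n => ?_
      simp only [Function.comp_apply, pow_one, PNat.one_coe, Nat.cast_one,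
        mul_one]
      rw [← Complex.exp_nat_mul]
      have : Complex.exp ((n : ℕ) * (2 * Real.pi * Complex.I * ((w + v.val) / q))) =
          Complex.exp (2 * Real.pi * Complex.I * (n : ℕ) * (w / q)) *
          Complex.exp (2 * Real.pi * Complex.I * (n : ℕ) * ((v.val : ℂ) / q)) := by
        rw [← Complex.exp_add]; congr 1; field_simp
      rw [this]
      ring
  · intro v _
    have h := EisensteinSeries.linear_right_summable ((w + v.val) / q) 1 (k := 2) le_rfl
    refine (h.mul_left (χ v / q ^ 2)).congr fun l => ?_
    simp

theorem im_natCast_mul (n : ℕ) (z : ℂ) : ((n : ℂ) * z).im = n * z.im := by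
  simp

section

variable {q₁ q₂ : ℕ} (χ₁ : DirichletCharacter ℂ q₁) {χ₂ : DirichletCharacter ℂ q₂}

/-- The row with first coordinate `c` in the lattice sum defining the Eisenstein series. -/
def eisRow (χ₁ : DirichletCharacter ℂ q₁) (χ₂ : DirichletCharacter ℂ q₂) (z : ℂ) (c : ℤ) : ℂ :=
  χ₁ (c : ZMod q₁) * ∑' d : ℤ, χ₂ (d : ZMod q₂) / latPt (q₂ * z) 1 (c, d) ^ 2

/-- The previous formula at w = c q₂ z: the factor q₂ in the lattice basis cancels the denominator
in the exponential, leaving e(cnz). -/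
theorem eisRow_pos [NeZero q₂] (hχ₂ : χ₂.IsPrimitive) {z : ℂ} (hz : 0 < z.im) (c : ℕ+) :
    eisRow χ₁ χ₂ z (c : ℕ) = (2 * Real.pi * Complex.I / q₂) ^ 2 * tau χ₂ *
      ∑' n : ℕ+, pairCoeff χ₁ χ₂ (c, n) * (n : ℕ) * pairExp (c, n) z := by
  have hq : (q₂ : ℂ) ≠ 0 := Nat.cast_ne_zero.2 (NeZero.ne q₂)
  have hw : 0 < (((c : ℕ) : ℂ) * (q₂ * z)).im := by
    rw [im_natCast_mul, im_natCast_mul]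
    exact mul_pos (Nat.cast_pos.2 c.pos)
      (mul_pos (Nat.cast_pos.2 (Nat.pos_of_ne_zero (NeZero.ne q₂))) hz)
  have h := tsum_char_div_sq hχ₂ hw
  simp only [eisRow, latPt, mul_one, Int.cast_natCast]
  rw [h, ← tsum_mul_left, ← tsum_mul_left, ← tsum_mul_left]
  refine tsum_congr fun n => ?_
  have e : 2 * Real.pi * Complex.I * ((n : ℕ) : ℂ) * (((c : ℕ) : ℂ) * (q₂ * z) / q₂) =
      2 * Real.pi * Complex.I * (((c * n : ℕ+) : ℕ) : ℂ) * z := by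
    push_cast; field_simp
  rw [e, pairCoeff, pairExp]
  ring

theorem even_eisRow (hpar : χ₁ (-1) * χ₂ (-1) = 1) (z : ℂ) :
    Function.Even (eisRow χ₁ χ₂ z) := by
  intro c
  rw [eisRow, eisRow, ← (Equiv.neg ℤ).tsum_eq]
  have h : ∀ d : ℤ, χ₂ ((Equiv.neg ℤ d : ℤ) : ZMod q₂) / latPt (q₂ * z) 1 (-c, Equiv.neg ℤ d) ^ 2 =
      χ₂ (-1) * (χ₂ (d : ZMod q₂) / latPt (q₂ * z) 1 (c, d) ^ 2) := by
    intro d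
    have e : latPt (q₂ * z) 1 (-c, Equiv.neg ℤ d) = - latPt (q₂ * z) 1 (c, d) := by
      simp [latPt]; ring
    rw [e, neg_sq, Equiv.neg_apply, Int.cast_neg, neg_eq_neg_one_mul, map_mul, mul_div_assoc]
  simp only [h]
  rw [tsum_mul_left, Int.cast_neg, neg_eq_neg_one_mul, map_mul]
  linear_combination (χ₁ (c : ZMod q₁) *
    ∑' d : ℤ, χ₂ (d : ZMod q₂) / latPt (q₂ * z) 1 (c, d) ^ 2) * hpar

theorem tsum_char_div_sq_eq_LFunction [NeZero q₂] (heven : χ₂ (-1) = 1) :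
    ∑' d : ℤ, χ₂ (d : ZMod q₂) / (d : ℂ) ^ 2 = 2 * χ₂.LFunction 2 := by
  have hs : Summable fun d : ℤ => χ₂ (d : ZMod q₂) / (d : ℂ) ^ 2 := by
    simpa using summable_char_div_sq χ₂ 0
  have he : Function.Even fun d : ℤ => χ₂ (d : ZMod q₂) / (d : ℂ) ^ 2 := by
    intro d
    simp only [Int.cast_neg, neg_sq]
    rw [neg_eq_neg_one_mul, map_mul, heven, one_mul]
  -- The term d = 0 counts as 0 by the convention x / 0 = 0; this matters for q₂ = 1, where χ₂(0) =
  -- 1.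
  rw [tsum_int_eq_zero_add_two_mul_tsum_pnat he hs,
    DirichletCharacter.LFunction_eq_LSeries _ (by norm_num), LSeries]
  have hs2 : Summable fun n : ℕ => LSeries.term (fun x => χ₂ (x : ZMod q₂)) 2 n :=
    DirichletCharacter.LSeriesSummable_of_one_lt_re χ₂ (by norm_num)
  rw [← tsum_zero_pnat_eq_tsum_nat hs2]
  simp only [Int.cast_zero, ne_eq, OfNat.ofNat_ne_zero, not_false_eq_true, zero_pow, div_zero,
    zero_add, LSeries.term_zero, nsmul_eq_mul, Nat.cast_ofNat]
  congr 1
  refine tsum_congr fun n => ?_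
  rw [LSeries.term_of_ne_zero n.ne_zero]
  simp

theorem summable_eisRow [NeZero q₂] (hχ₂ : χ₂.IsPrimitive) (hpar : χ₁ (-1) * χ₂ (-1) = 1) {z : ℂ}
    (hz : 0 < z.im) : Summable (eisRow χ₁ χ₂ z) := by
  have h1 : Summable fun c : ℕ => eisRow χ₁ χ₂ z c := by
    rw [← summable_pnat_iff_summable_nat]
    simp only [eisRow_pos χ₁ hχ₂ hz]
    exact (summable_eisDeriv_pairs χ₁ χ₂ hz).prod.mul_left _
  refine Summable.of_nat_of_neg h1 ?_
  simpa only [(even_eisRow χ₁ hpar z) _] using h1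

theorem tsum_eisRow [NeZero q₁] [NeZero q₂] (hχ₂ : χ₂.IsPrimitive) (hpar : χ₁ (-1) * χ₂ (-1) = 1) {z : ℂ}
    (hz : 0 < z.im) :
    ∑' c : ℤ, eisRow χ₁ χ₂ z c =
      4 * Real.pi * Complex.I / (q₂ : ℂ) ^ 2 * tau χ₂ * eisDeriv χ₁ χ₂ z := by
  have hq : (q₂ : ℂ) ≠ 0 := Nat.cast_ne_zero.2 (NeZero.ne q₂)
  have hpi : (Real.pi : ℂ) ≠ 0 := Complex.ofReal_ne_zero.2 Real.pi_ne_zero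
  have hτ := tau_ne_zero hχ₂
  rw [tsum_int_eq_zero_add_two_mul_tsum_pnat (even_eisRow χ₁ hpar z)
    (summable_eisRow χ₁ hχ₂ hpar hz)]
  simp only [eisRow_pos χ₁ hχ₂ hz]
  rw [tsum_mul_left, ← (summable_eisDeriv_pairs χ₁ χ₂ hz).tsum_prod, eisDeriv]
  -- The row c = 0 is the constant term of F': it survives only for q₁ = 1, where it is 2L(2, χ₂).
  have h0 : eisRow χ₁ χ₂ z 0 = 4 * Real.pi * Complex.I / (q₂ : ℂ) ^ 2 * tau χ₂ *
      linCoeff χ₂ q₁ := by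
    by_cases h1 : q₁ = 1
    · subst h1
      have e : ∀ x : ZMod 1, χ₁ x = 1 := fun x => by
        rw [Subsingleton.elim x 1, map_one]
      have heven : χ₂ (-1) = 1 := by rw [← hpar, e, one_mul]
      simp only [eisRow, latPt, e, Int.cast_zero, zero_mul, zero_add, mul_one, one_mul]
      rw [tsum_char_div_sq_eq_LFunction heven, linCoeff, if_pos rfl]
      field_simp
      ring
    · rw [linCoeff, if_neg h1, eisRow, Int.cast_zero, DirichletCharacter.map_zero' _ h1]
      ring
  rw [h0, nsmul_eq_mul]
  push_cast
  field_simp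
  ring

/-! ### Division values and the modularity of F' -/

theorem castHom_intCast {q N : ℕ} (h : q ∣ N) (x : ℤ) :
    ZMod.castHom h (ZMod q) (x : ZMod N) = x :=
  map_intCast _ x

/-- A primitive character of nontrivial level sums to zero over `ℤ/N`. -/
theorem sum_castHom_eq_zero {q N : ℕ} [NeZero N] (hqN : q ∣ N) {χ : DirichletCharacter ℂ q}
    (hχ : χ.IsPrimitive) (hq : q ≠ 1) :
    ∑ v : ZMod N, χ (ZMod.castHom hqN (ZMod q) v) = 0 := by
  have : NeZero q := ⟨by rintro rfl; exact NeZero.ne N (Nat.eq_zero_of_zero_dvd hqN)⟩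
  have hne : χ ≠ 1 := fun h => hq (by
    rw [← (DirichletCharacter.isPrimitive_def χ).1 hχ, h, DirichletCharacter.conductor_one])
  obtain ⟨u, hu⟩ := MulChar.ne_one_iff.1 hne
  -- A unit with χ ≠ 1 lifts to ℤ/N; multiplication by the lift permutes ℤ/N and scales the sum by
  -- χ(u).
  obtain ⟨w, rfl⟩ := ZMod.unitsMap_surjective hqN u
  have h : χ (ZMod.castHom hqN (ZMod q) (w : ZMod N)) *
      ∑ v : ZMod N, χ (ZMod.castHom hqN (ZMod q) v) =
      ∑ v : ZMod N, χ (ZMod.castHom hqN (ZMod q) v) := by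
    rw [Finset.mul_sum, ← Equiv.sum_comp (Units.mulLeft w)
      (fun v => χ (ZMod.castHom hqN (ZMod q) v))]
    refine Finset.sum_congr rfl fun v _ => ?_
    rw [Units.mulLeft_apply, map_mul, map_mul]
  by_contra h0
  exact hu (mul_right_cancel₀ h0 (h.trans (one_mul _).symm))

end

/-- The period pair `(τ, 1)`. -/
def upperPair (τ : ℂ) (hτ : 0 < τ.im) : PeriodPair where
  ω₁ := τ
  ω₂ := 1
  indep := by
    rw [LinearIndependent.pair_iff]
    intro s t h
    have him := congrArg Complex.im h
    simp only [Complex.real_smul, mul_one, Complex.add_im, Complex.im_ofReal_mul, Complex.ofReal_im,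
      add_zero, Complex.zero_im, mul_eq_zero, hτ.ne', or_false] at him
    subst him
    simpa using h

/-- The product of two characters, as a function on `(ℤ/N)²`. -/
def prodChar {q₁ q₂ : ℕ} (N : ℕ) (χ₁ : DirichletCharacter ℂ q₁) (χ₂ : DirichletCharacter ℂ q₂)
    (h₁ : q₁ ∣ N) (h₂ : q₂ ∣ N) (v : ZMod N × ZMod N) : ℂ :=
  χ₁ (ZMod.castHom h₁ (ZMod q₁) v.1) * χ₂ (ZMod.castHom h₂ (ZMod q₂) v.2)

theorem prodChar_intCast {q₁ q₂ N : ℕ} (χ₁ : DirichletCharacter ℂ q₁)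
    (χ₂ : DirichletCharacter ℂ q₂) (h₁ : q₁ ∣ N) (h₂ : q₂ ∣ N) (x y : ℤ) :
    prodChar N χ₁ χ₂ h₁ h₂ ((x : ZMod N), (y : ZMod N)) =
      χ₁ (x : ZMod q₁) * χ₂ (y : ZMod q₂) := by
  rw [prodChar, castHom_intCast, castHom_intCast]

/-- The derivative of `F` as a weighted sum of division values of the Weierstrass function. -/
theorem divSum_prodChar {q₁ q₂ N : ℕ} [NeZero q₁] [NeZero q₂] [NeZero N]
    {χ₁ : DirichletCharacter ℂ q₁} {χ₂ : DirichletCharacter ℂ q₂} (h₁ : q₁ ∣ N) (h₂ : q₂ ∣ N)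
    (hχ₁ : χ₁.IsPrimitive) (hχ₂ : χ₂.IsPrimitive) (hq : q₁ * q₂ ≠ 1)
    (hpar : χ₁ (-1) * χ₂ (-1) = 1) {z : ℂ} (hz : 0 < z.im) :
    divSum N (q₂ * z) 1 (prodChar N χ₁ χ₂ h₁ h₂) =
      (N : ℂ) ^ 2 * (4 * Real.pi * Complex.I / (q₂ : ℂ) ^ 2 * tau χ₂ * eisDeriv χ₁ χ₂ z) := by
  have hw : 0 < ((q₂ : ℂ) * z).im := by
    rw [im_natCast_mul]
    exact mul_pos (Nat.cast_pos.2 (Nat.pos_of_ne_zero (NeZero.ne q₂))) hz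
  have hrow : ∀ c : ℤ, Summable fun d : ℤ => χ₂ (ZMod.castHom h₂ (ZMod q₂) (d : ZMod N)) /
      latPt (q₂ * z) 1 (c, d) ^ 2 := fun c => by
    simpa only [castHom_intCast, latPt, mul_one] using summable_char_div_sq χ₂ (c * (q₂ * z))
  have hsum : Summable fun c : ℤ => χ₁ (ZMod.castHom h₁ (ZMod q₁) (c : ZMod N)) *
      ∑' d : ℤ, χ₂ (ZMod.castHom h₂ (ZMod q₂) (d : ZMod N)) / latPt (q₂ * z) 1 (c, d) ^ 2 := by
    simp only [castHom_intCast]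
    exact summable_eisRow χ₁ hχ₂ hpar hz
  have h := divSum_eq_tsum_rows (N := N) (upperPair _ hw)
    (fun v => χ₁ (ZMod.castHom h₁ (ZMod q₁) v)) (fun v => χ₂ (ZMod.castHom h₂ (ZMod q₂) v)) ?_
    hrow hsum
  · rw [← tsum_eisRow χ₁ hχ₂ hpar hz]
    simp only [castHom_intCast] at h
    exact h
  -- Since q₁q₂ ≠ 1, at least one factor has nontrivial level and sums to zero.
  · by_cases h1 : q₁ = 1
    · rw [sum_castHom_eq_zero h₂ hχ₂ (by rintro rfl; exact hq (by rw [h1])), mul_zero]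
    · rw [sum_castHom_eq_zero h₁ hχ₁ h1, zero_mul]

/-- Transformation of the weight two Eisenstein series attached to a pair of characters. -/
theorem eisDeriv_transform {q₁ q₂ q₁' q₂' N : ℕ} [NeZero q₁] [NeZero q₂] [NeZero q₁'] [NeZero q₂']
    [NeZero N] {χ₁ : DirichletCharacter ℂ q₁} {χ₂ : DirichletCharacter ℂ q₂}
    {χ₁' : DirichletCharacter ℂ q₁'} {χ₂' : DirichletCharacter ℂ q₂'}
    (h₁ : q₁ ∣ N) (h₂ : q₂ ∣ N) (h₁' : q₁' ∣ N) (h₂' : q₂' ∣ N)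
    (hχ₁ : χ₁.IsPrimitive) (hχ₂ : χ₂.IsPrimitive)
    (hχ₁' : χ₁'.IsPrimitive) (hχ₂' : χ₂'.IsPrimitive)
    (hq : q₁ * q₂ ≠ 1) (hq' : q₁' * q₂' ≠ 1)
    (hpar : χ₁ (-1) * χ₂ (-1) = 1) (hpar' : χ₁' (-1) * χ₂' (-1) = 1)
    {z w : ℂ} (hz : 0 < z.im) (hw : 0 < w.im) {j k κ : ℂ} (hj : j ≠ 0) (hk : k ≠ 0)
    {a b c d : ℤ} (hdet : a * d - b * c = 1)
    (hjw : j * (q₂ * w) = k * (a * (q₂' * z) + b)) (hjk : j = k * (c * (q₂' * z) + d))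
    (hchar : ∀ x y : ℤ, χ₁ (x : ZMod q₁) * χ₂ (y : ZMod q₂) =
      κ * (χ₁' ((x * a + y * c : ℤ) : ZMod q₁') * χ₂' ((x * b + y * d : ℤ) : ZMod q₂'))) :
    eisDeriv χ₁ χ₂ w / j ^ 2 =
      κ * ((q₂ : ℂ) ^ 2 * tau χ₂') / ((q₂' : ℂ) ^ 2 * tau χ₂ * k ^ 2) * eisDeriv χ₁' χ₂' z := by
  have hN : (N : ℂ) ≠ 0 := Nat.cast_ne_zero.2 (NeZero.ne N)
  have hq₂ : (q₂ : ℂ) ≠ 0 := Nat.cast_ne_zero.2 (NeZero.ne q₂)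
  have hq₂' : (q₂' : ℂ) ≠ 0 := Nat.cast_ne_zero.2 (NeZero.ne q₂')
  have hpi : (Real.pi : ℂ) ≠ 0 := Complex.ofReal_ne_zero.2 Real.pi_ne_zero
  have hτ := tau_ne_zero hχ₂
  have hz' : 0 < ((q₂' : ℂ) * z).im := by
    rw [im_natCast_mul]
    exact mul_pos (Nat.cast_pos.2 (Nat.pos_of_ne_zero (NeZero.ne q₂'))) hz
  have H := divSum_coordEquiv (N := N) (upperPair _ hz') a b c d hdet
    (prodChar N χ₁ χ₂ h₁ h₂) (fun v => κ * prodChar N χ₁' χ₂' h₁' h₂' v) (fun x y => by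
      rw [prodChar_intCast, prodChar_intCast]; exact hchar x y)
  rw [divSum_const_mul] at H
  change divSum N (a * (q₂' * z) + b * 1) (c * (q₂' * z) + d * 1) _ =
    κ * divSum N (q₂' * z) 1 _ at H
  rw [mul_one, mul_one, divSum_prodChar h₁' h₂' hχ₁' hχ₂' hq' hpar' hz] at H
  -- By `hjw` and `hjk`, scaling (q₂w, 1) by j and the transformed basis by k gives the same
  -- periods; comparing the two scalings yields the factors j² and k².
  have e1 := divSum_mul N k (a * (q₂' * z) + b) (c * (q₂' * z) + d) (prodChar N χ₁ χ₂ h₁ h₂)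
  have e2 := divSum_mul N j (q₂ * w) 1 (prodChar N χ₁ χ₂ h₁ h₂)
  rw [← hjw, ← hjk, H] at e1
  rw [mul_one, e1, divSum_prodChar h₁ h₂ hχ₁ hχ₂ hq hpar hw] at e2
  field_simp at e2 ⊢
  linear_combination -e2

/-! ### Constancy of the cocycles -/

theorem moebius_denom_ne_zero {A B C D : ℝ} (hdet : 0 < A * D - B * C) {z : ℂ} (hz : 0 < z.im) :
    (C : ℂ) * z + D ≠ 0 := by
  intro h
  have him := congrArg Complex.im h
  have hre := congrArg Complex.re h
  simp only [Complex.add_im, Complex.im_ofReal_mul, Complex.ofReal_im, add_zero, Complex.zero_im,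
    mul_eq_zero, hz.ne', or_false] at him
  simp only [him, Complex.ofReal_zero, zero_mul, zero_add, Complex.ofReal_re,
    Complex.zero_re] at hre
  rw [him, hre] at hdet
  simp at hdet

theorem moebius_im_pos {A B C D : ℝ} (hdet : 0 < A * D - B * C) {z : ℂ} (hz : 0 < z.im) :
    0 < (((A : ℂ) * z + B) / (C * z + D)).im := by
  have h0 := moebius_denom_ne_zero hdet hz
  have h1 : (((A : ℂ) * z + B) / (C * z + D)).im =
      (A * D - B * C) * z.im / Complex.normSq (C * z + D) := by
    rw [Complex.div_im]
    simp only [Complex.add_im, Complex.add_re, Complex.im_ofReal_mul, Complex.re_ofReal_mul,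
      Complex.ofReal_im, Complex.ofReal_re, add_zero]
    ring
  rw [h1]
  exact div_pos (mul_pos hdet hz) (Complex.normSq_pos.2 h0)

/-- The hypothesis says that the derivative of the difference vanishes, by the chain rule; the upper
half-plane is connected. -/
theorem eisFExt_moebius_const {q₁ q₂ q₁' q₂' : ℕ} [NeZero q₁] [NeZero q₂] [NeZero q₁']
    [NeZero q₂'] (χ₁ : DirichletCharacter ℂ q₁) (χ₂ : DirichletCharacter ℂ q₂)
    (χ₁' : DirichletCharacter ℂ q₁') (χ₂' : DirichletCharacter ℂ q₂')
    {A B C D : ℝ} (hdet : 0 < A * D - B * C) (β : ℂ)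
    (h : ∀ z : ℂ, 0 < z.im → eisDeriv χ₁ χ₂ ((A * z + B) / (C * z + D)) *
      ((A * D - B * C) / (C * z + D) ^ 2) = β * eisDeriv χ₁' χ₂' z) {z w : ℂ}
    (hz : 0 < z.im) (hw : 0 < w.im) :
    eisFExt χ₁ χ₂ ((A * z + B) / (C * z + D)) - β * eisFExt χ₁' χ₂' z =
      eisFExt χ₁ χ₂ ((A * w + B) / (C * w + D)) - β * eisFExt χ₁' χ₂' w := by
  have H : ∀ z : ℂ, 0 < z.im → HasDerivAt (fun z : ℂ =>
      eisFExt χ₁ χ₂ ((A * z + B) / (C * z + D)) - β * eisFExt χ₁' χ₂' z) 0 z := by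
    intro z hz
    have h0 := moebius_denom_ne_zero hdet hz
    have hn : HasDerivAt (fun z : ℂ => (A : ℂ) * z + B) A z := by
      simpa using ((hasDerivAt_id z).const_mul (A : ℂ)).add_const (B : ℂ)
    have hd : HasDerivAt (fun z : ℂ => (C : ℂ) * z + D) C z := by
      simpa using ((hasDerivAt_id z).const_mul (C : ℂ)).add_const (D : ℂ)
    have hm := hn.div hd h0
    have h1 := HasDerivAt.comp z (hasDerivAt_eisFExt χ₁ χ₂ (moebius_im_pos hdet hz)) hm
    have h2 := h1.sub ((hasDerivAt_eisFExt χ₁' χ₂' hz).const_mul β)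
    refine h2.congr_deriv ?_
    simp only [Pi.div_apply]
    rw [← h z hz]
    ring
  exact IsOpen.is_const_of_deriv_eq_zero (𝕜 := ℂ) (s := {z : ℂ | 0 < z.im})
    (isOpen_lt continuous_const Complex.continuous_im)
    (convex_halfSpace_im_gt 0).isPreconnected
    (fun z hz => (H z hz).differentiableAt.differentiableWithinAt)
    (fun z hz => (H z hz).deriv) hz hw

/-! ### Values of products and local parts of characters at integers -/

theorem changeLevel_mul_changeLevel_intCast {m n q : ℕ} (hm : m ∣ q) (hn : n ∣ q)
    (hq : q ∣ m * n) (χ : DirichletCharacter ℂ m) (χ' : DirichletCharacter ℂ n) (x : ℤ) :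
    (DirichletCharacter.changeLevel hm χ * DirichletCharacter.changeLevel hn χ') (x : ZMod q) =
      χ (x : ZMod m) * χ' (x : ZMod n) := by
  rw [MulChar.mul_apply]
  by_cases hx : IsCoprime x (q : ℤ)
  · rw [DirichletCharacter.changeLevel_eq_cast_of_dvd' _ _ hx,
      DirichletCharacter.changeLevel_eq_cast_of_dvd' _ _ hx]
  -- At non-units both sides vanish: as q ∣ mn, an integer prime to m and n is prime to q.
  · rw [(DirichletCharacter.apply_eq_zero_iff _ x).2 hx, zero_mul, eq_comm, mul_eq_zero]
    by_contra! h
    have h1 := (DirichletCharacter.apply_ne_zero_iff χ x).1 h.1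
    have h2 := (DirichletCharacter.apply_ne_zero_iff χ' x).1 h.2
    exact hx ((h1.mul_right h2).of_isCoprime_of_dvd_right (by exact_mod_cast hq))

theorem localPart_mul_localPart_intCast {q Q R : ℕ} (hQR : Q.Coprime R) (hq : q ∣ Q * R)
    (hq' : q ∣ R * Q) (χ : DirichletCharacter ℂ q) (x : ℤ) :
    χ (x : ZMod q) = localPart hQR hq χ (x : ZMod (q.gcd Q)) *
      localPart hQR.symm hq' χ (x : ZMod (q.gcd R)) := by
  conv_lhs => rw [localPart_mul_localPart hQR hq χ]
  exact changeLevel_mul_changeLevel_intCast _ _ (gcd_mul_gcd hQR hq).symm.dvd _ _ _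

theorem intCast_eq_of_dvd {q : ℕ} {a b : ℤ} (h : (q : ℤ) ∣ a - b) : (a : ZMod q) = b := by
  rw [eq_comm, ZMod.intCast_eq_intCast_iff_dvd_sub]
  exact h

theorem localPart_intCast_of_congr {q Q R : ℕ} (hQR : Q.Coprime R) (hq : q ∣ Q * R)
    (χ : DirichletCharacter ℂ q) {m n : ℤ} (hm : (Q : ℤ) ∣ m - n) (hm1 : (R : ℤ) ∣ m - 1) :
    localPart hQR hq χ (n : ZMod (q.gcd Q)) = χ (m : ZMod q) := by
  rw [localPart_mul_localPart_intCast hQR hq (mul_comm Q R ▸ hq),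
    intCast_eq_of_dvd (q := q.gcd Q) ((Int.natCast_dvd_natCast.2 (Nat.gcd_dvd_right q Q)).trans hm),
    intCast_eq_of_dvd (q := q.gcd R)
      ((Int.natCast_dvd_natCast.2 (Nat.gcd_dvd_right q R)).trans hm1),
    Int.cast_one, map_one, mul_one]

theorem nebentypus_intCast {q₁ q₂ : ℕ} (χ₁ : DirichletCharacter ℂ q₁)
    (χ₂ : DirichletCharacter ℂ q₂) (x : ℤ) :
    nebentypus χ₁ χ₂ (x : ZMod (q₁ * q₂)) = χ₁ (x : ZMod q₁) * (χ₂ (x : ZMod q₂))⁻¹ := by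
  rw [nebentypus, changeLevel_mul_changeLevel_intCast _ _ dvd_rfl, MulChar.inv_apply_eq_inv']

theorem localPart_nebentypus {q₁ q₂ Q R : ℕ} (hQR : Q.Coprime R) (h : q₁ * q₂ ∣ Q * R)
    (h₁ : q₁ ∣ Q * R) (h₂ : q₂ ∣ Q * R)
    (χ₁ : DirichletCharacter ℂ q₁) (χ₂ : DirichletCharacter ℂ q₂) (n : ℤ) :
    localPart hQR h (nebentypus χ₁ χ₂) (n : ZMod ((q₁ * q₂).gcd Q)) =
      localPart hQR h₁ χ₁ (n : ZMod (q₁.gcd Q)) *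
        (localPart hQR h₂ χ₂ (n : ZMod (q₂.gcd Q)))⁻¹ := by
  obtain ⟨a, b, hab⟩ := Nat.isCoprime_iff_coprime.2 hQR
  -- By Bézout this integer is n modulo Q and 1 modulo R, so all three local parts are values of
  -- full characters at it.
  have hm : (Q : ℤ) ∣ (n * b * R + a * Q) - n := ⟨a - n * a, by linear_combination n * hab⟩
  have hm1 : (R : ℤ) ∣ (n * b * R + a * Q) - 1 := ⟨n * b - b, by linear_combination hab⟩
  rw [localPart_intCast_of_congr hQR h _ hm hm1, localPart_intCast_of_congr hQR h₁ _ hm hm1,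
    localPart_intCast_of_congr hQR h₂ _ hm hm1, nebentypus_intCast]

/-! ### Primitivity -/

/-- The conductor of a product divides the lcm of the conductors, so q divides cond(χ^(Q))·(q, R);
coprimality leaves (q, Q) ∣ cond(χ^(Q)). -/
theorem isPrimitive_localPart {q Q R : ℕ} [NeZero q] (hQR : Q.Coprime R) (hq : q ∣ Q * R)
    {χ : DirichletCharacter ℂ q} (hχ : χ.IsPrimitive) : (localPart hQR hq χ).IsPrimitive := by
  have hq' : q ∣ R * Q := mul_comm Q R ▸ hq
  have h := DirichletCharacter.conductor_mul_dvd_lcm_conductor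
    (DirichletCharacter.changeLevel (Nat.gcd_dvd_left q Q) (localPart hQR hq χ))
    (DirichletCharacter.changeLevel (Nat.gcd_dvd_left q R) (localPart hQR.symm hq' χ))
  rw [← localPart_mul_localPart hQR hq χ, DirichletCharacter.conductor_changeLevel,
    DirichletCharacter.conductor_changeLevel, (DirichletCharacter.isPrimitive_def χ).1 hχ] at h
  have h1 : q.gcd Q ∣ (localPart hQR hq χ).conductor * q.gcd R :=
    ((Nat.gcd_dvd_left q Q).trans h).trans ((Nat.lcm_dvd_mul _ _).trans
      (mul_dvd_mul_left _ (DirichletCharacter.conductor_dvd_level _)))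
  exact Nat.dvd_antisymm (DirichletCharacter.conductor_dvd_level _)
    ((hQR.gcd_both q q).dvd_of_dvd_mul_right h1)

/-- Dividing the product φ by χ' recovers χ, so m divides cond(φ)·n, and n is prime to m. -/
theorem level_dvd_conductor_mul {m n : ℕ} [NeZero m] [NeZero n] (hmn : m.Coprime n)
    {χ : DirichletCharacter ℂ m} (χ' : DirichletCharacter ℂ n) (hχ : χ.IsPrimitive)
    {q : ℕ} [NeZero q] (hm : m ∣ q) (hn : n ∣ q) :
    m ∣ (DirichletCharacter.changeLevel hm χ * DirichletCharacter.changeLevel hn χ').conductor := by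
  set φ := DirichletCharacter.changeLevel hm χ * DirichletCharacter.changeLevel hn χ' with hφ
  have h := DirichletCharacter.conductor_mul_dvd_lcm_conductor φ
    (DirichletCharacter.changeLevel hn χ')⁻¹
  rw [hφ, mul_inv_cancel_right, ← hφ, DirichletCharacter.conductor_changeLevel,
    DirichletCharacter.conductor_inv, DirichletCharacter.conductor_changeLevel,
    (DirichletCharacter.isPrimitive_def χ).1 hχ] at h
  exact hmn.dvd_of_dvd_mul_right (h.trans ((Nat.lcm_dvd_mul _ _).trans
    (mul_dvd_mul_left _ (DirichletCharacter.conductor_dvd_level _))))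

theorem isPrimitive_changeLevel_mul {m n : ℕ} [NeZero m] [NeZero n] (hmn : m.Coprime n)
    {χ : DirichletCharacter ℂ m} {χ' : DirichletCharacter ℂ n} (hχ : χ.IsPrimitive)
    (hχ' : χ'.IsPrimitive) :
    (DirichletCharacter.changeLevel (dvd_mul_right m n) χ *
      DirichletCharacter.changeLevel (dvd_mul_left n m) χ').IsPrimitive := by
  refine Nat.dvd_antisymm (DirichletCharacter.conductor_dvd_level _)
    (hmn.mul_dvd_of_dvd_of_dvd (level_dvd_conductor_mul hmn χ' hχ _ _) ?_)
  have h := level_dvd_conductor_mul hmn.symm χ hχ' (dvd_mul_left n m) (dvd_mul_right m n)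
  rwa [mul_comm (DirichletCharacter.changeLevel (dvd_mul_left n m) χ')] at h

theorem gcd_mul_gcd_eq {q₁ q₂ Q R : ℕ} (hQR : Q.Coprime R) (hN : q₁ * q₂ = Q * R) :
    q₁.gcd Q * q₂.gcd Q = Q := by
  have h₁ := gcd_mul_gcd hQR (dvd_fst hN)
  have h₂ := gcd_mul_gcd hQR (dvd_snd hN)
  have h : (q₁.gcd Q * q₂.gcd Q) * (q₁.gcd R * q₂.gcd R) = Q * R := by
    rw [← hN]
    conv_rhs => rw [← h₁, ← h₂]
    ring
  refine Nat.dvd_antisymm ?_ ?_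
  · refine Nat.Coprime.dvd_of_dvd_mul_right (n := R) ?_ (h ▸ dvd_mul_right _ _)
    exact (hQR.coprime_dvd_left (Nat.gcd_dvd_right _ _)).mul_left
      (hQR.coprime_dvd_left (Nat.gcd_dvd_right _ _))
  · refine Nat.Coprime.dvd_of_dvd_mul_right (n := q₁.gcd R * q₂.gcd R) ?_ (h ▸ dvd_mul_right _ _)
    exact (hQR.coprime_dvd_right (Nat.gcd_dvd_right _ _)).mul_right
      (hQR.coprime_dvd_right (Nat.gcd_dvd_right _ _))

section Swap

variable {q₁ q₂ Q R : ℕ} (hQR : Q.Coprime R) (hN : q₁ * q₂ = Q * R)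
  (χ₁ : DirichletCharacter ℂ q₁) (χ₂ : DirichletCharacter ℂ q₂)

theorem swapFst_intCast (h₁ : q₁ ∣ R * Q) (x : ℤ) :
    swapFst hQR hN χ₁ χ₂ (x : ZMod (q₂.gcd Q * q₁.gcd R)) =
      localPart hQR (dvd_snd hN) χ₂ (x : ZMod (q₂.gcd Q)) *
        localPart hQR.symm h₁ χ₁ (x : ZMod (q₁.gcd R)) :=
  changeLevel_mul_changeLevel_intCast _ _ dvd_rfl _ _ x

theorem swapSnd_intCast (h₂ : q₂ ∣ R * Q) (x : ℤ) :
    swapSnd hQR hN χ₁ χ₂ (x : ZMod (q₁.gcd Q * q₂.gcd R)) =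
      localPart hQR (dvd_fst hN) χ₁ (x : ZMod (q₁.gcd Q)) *
        localPart hQR.symm h₂ χ₂ (x : ZMod (q₂.gcd R)) :=
  changeLevel_mul_changeLevel_intCast _ _ dvd_rfl _ _ x

variable {χ₁ χ₂}

theorem isPrimitive_swapFst [NeZero q₁] [NeZero q₂] (hχ₁ : χ₁.IsPrimitive)
    (hχ₂ : χ₂.IsPrimitive) : (swapFst hQR hN χ₁ χ₂).IsPrimitive :=
  isPrimitive_changeLevel_mul (hQR.gcd_both _ _) (isPrimitive_localPart _ _ hχ₂)
    (isPrimitive_localPart _ _ hχ₁)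

theorem isPrimitive_swapSnd [NeZero q₁] [NeZero q₂] (hχ₁ : χ₁.IsPrimitive)
    (hχ₂ : χ₂.IsPrimitive) : (swapSnd hQR hN χ₁ χ₂).IsPrimitive :=
  isPrimitive_changeLevel_mul (hQR.gcd_both _ _) (isPrimitive_localPart _ _ hχ₁)
    (isPrimitive_localPart _ _ hχ₂)

theorem swap_neg_one (hpar : χ₁ (-1) * χ₂ (-1) = 1) :
    swapFst hQR hN χ₁ χ₂ (-1) * swapSnd hQR hN χ₁ χ₂ (-1) = 1 := by
  have h₁ : q₁ ∣ R * Q := mul_comm Q R ▸ dvd_fst hN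
  have h₂ : q₂ ∣ R * Q := mul_comm Q R ▸ dvd_snd hN
  have e1 := swapFst_intCast hQR hN χ₁ χ₂ h₁ (-1)
  have e2 := swapSnd_intCast hQR hN χ₁ χ₂ h₂ (-1)
  have f1 := localPart_mul_localPart_intCast hQR (dvd_fst hN) h₁ χ₁ (-1)
  have f2 := localPart_mul_localPart_intCast hQR (dvd_snd hN) h₂ χ₂ (-1)
  simp only [Int.cast_neg, Int.cast_one] at e1 e2 f1 f2
  rw [e1, e2, ← hpar, f1, f2]
  ring

end Swap

/-! ### The group `Γ₀(N)` -/

theorem phi_const {q₁ q₂ : ℕ} [NeZero q₁] [NeZero q₂] {χ₁ : DirichletCharacter ℂ q₁}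
    {χ₂ : DirichletCharacter ℂ q₂} (hχ₁ : χ₁.IsPrimitive) (hχ₂ : χ₂.IsPrimitive)
    (hq : q₁ * q₂ ≠ 1) (hpar : χ₁ (-1) * χ₂ (-1) = 1) {γ : SL(2, ℤ)}
    (hγ : ((q₁ * q₂ : ℕ) : ℤ) ∣ γ 1 0) (z w : ℍ) : phi χ₁ χ₂ γ z = phi χ₁ χ₂ γ w := by
  obtain ⟨c, hc⟩ := hγ
  have hdet := γ.det_coe
  rw [Matrix.det_fin_two, hc] at hdet
  set a := γ 0 0 with ha
  set b := γ 0 1 with hb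
  set d := γ 1 1 with hd
  have hdetR : (1 : ℝ) = (a : ℝ) * d - b * ((q₁ * q₂ : ℕ) * c : ℤ) := by
    exact_mod_cast hdet.symm
  have had₁ : χ₁ (a : ZMod q₁) * χ₁ (d : ZMod q₁) = 1 := by
    rw [← map_mul, ← Int.cast_mul, intCast_eq_of_dvd (b := 1) ⟨b * q₂ * c, ?_⟩, Int.cast_one,
      map_one]
    push_cast at hdet
    linear_combination hdet
  have had₂ : χ₂ (a : ZMod q₂) * χ₂ (d : ZMod q₂) = 1 := by
    rw [← map_mul, ← Int.cast_mul, intCast_eq_of_dvd (b := 1) ⟨b * q₁ * c, ?_⟩, Int.cast_one,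
      map_one]
    push_cast at hdet
    linear_combination hdet
  have hd₂ : χ₂ (d : ZMod q₂) ≠ 0 := right_ne_zero_of_mul_eq_one had₂
  have hτ := tau_ne_zero hχ₂
  have hq₂ : (q₂ : ℂ) ≠ 0 := Nat.cast_ne_zero.2 (NeZero.ne q₂)
  have hcoe : ∀ z : ℍ, ((γ • z : ℍ) : ℂ) =
      (((a : ℝ) : ℂ) * z + (b : ℝ)) / ((((q₁ * q₂ : ℕ) * c : ℤ) : ℝ) * z + (d : ℝ)) := by
    intro z
    rw [UpperHalfPlane.coe_specialLinearGroup_apply, hc]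
    simp [ha, hb, hd]
  simp only [phi, eisF_eq_eisFExt, hcoe]
  refine eisFExt_moebius_const χ₁ χ₂ χ₁ χ₂ (by rw [← hdetR]; exact one_pos) _
    (fun z hz => ?_) z.2 w.2
  have hpos : 0 < (a : ℝ) * d - b * ((q₁ * q₂ : ℕ) * c : ℤ) := by rw [← hdetR]; exact one_pos
  have hj := moebius_denom_ne_zero hpos hz
  have hdetC : ((a : ℝ) : ℂ) * (d : ℝ) - (b : ℝ) * ((((q₁ * q₂ : ℕ) * c : ℤ) : ℝ) : ℂ) = 1 := by
    exact_mod_cast congrArg (Complex.ofReal) hdetR.symm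
  -- The matrix is γ conjugated by diag(q₂, 1), because the lattice basis is (q₂z, 1).
  have key := eisDeriv_transform (N := q₁ * q₂) (dvd_mul_right _ _) (dvd_mul_left _ _)
    (dvd_mul_right _ _) (dvd_mul_left _ _) hχ₁ hχ₂ hχ₁ hχ₂ hq hq hpar hpar hz
    (moebius_im_pos hpos hz) (k := 1) (κ := charMat (nebentypus χ₁ χ₂) γ) hj one_ne_zero
    (a := a) (b := q₂ * b) (c := q₁ * c) (d := d)
    (by push_cast at hdet; linear_combination hdet)
    (by field_simp; push_cast; ring) (by push_cast; ring) ?_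
  · rw [hdetC, mul_one_div, key]
    field_simp
  · intro x y
    rw [charMat, nebentypus_intCast,
      intCast_eq_of_dvd (q := q₁) (a := x * a + y * (q₁ * c)) (b := x * a) ⟨y * c, by ring⟩,
      intCast_eq_of_dvd (q := q₂) (a := x * (q₂ * b) + y * d) (b := y * d) ⟨x * b, by ring⟩]
    push_cast
    rw [map_mul, map_mul, ← hd]
    field_simp
    linear_combination -(χ₁ (x : ZMod q₁) * χ₂ (y : ZMod q₂)) * had₁

/-! ### Atkin–Lehner operators -/

theorem swap_level_mul {q₁ q₂ Q R : ℕ} (hQR : Q.Coprime R) (hN : q₁ * q₂ = Q * R) :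
    q₂.gcd Q * q₁.gcd R * (q₁.gcd Q * q₂.gcd R) = q₁ * q₂ := by
  have h₁ := gcd_mul_gcd hQR (dvd_fst hN)
  have h₂ := gcd_mul_gcd hQR (dvd_snd hN)
  conv_rhs => rw [← h₁, ← h₂]
  ring

section AtkinLehner

variable {q₁ q₂ Q R : ℕ} {χ₁ : DirichletCharacter ℂ q₁} {χ₂ : DirichletCharacter ℂ q₂}

theorem coe_toGL_smul [NeZero Q] {r₀ u₀ : ℤ} (W : AtkinLehner Q R r₀ u₀) (z : ℍ) :
    ((W.toGL • z : ℍ) : ℂ) = (((Q * W.r : ℤ) : ℝ) * z + (W.t : ℝ)) /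
      (((Q * R * W.u : ℤ) : ℝ) * z + ((Q * W.v : ℤ) : ℝ)) := by
  have hdet : 0 < (Matrix.GeneralLinearGroup.det W.toGL : ℝ) := by
    have h : (Matrix.GeneralLinearGroup.det W.toGL : ℝ) = (Q : ℝ) := by
      have h1 : (W.mat.map (Int.cast : ℤ → ℝ)).det = ((W.mat.det : ℤ) : ℝ) :=
        ((Int.castRingHom ℝ).map_det W.mat).symm
      rw [W.det_mat, Int.cast_natCast] at h1
      exact h1
    rw [h]
    exact Nat.cast_pos.2 (Nat.pos_of_ne_zero (NeZero.ne Q))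
  rw [UpperHalfPlane.coe_smul_of_det_pos hdet]
  rfl

theorem localPart_ne_zero {q Q R : ℕ} (hQR : Q.Coprime R) (hq : q ∣ Q * R)
    (χ : DirichletCharacter ℂ q) {x : ℤ} (hx : IsCoprime x (Q : ℤ)) :
    localPart hQR hq χ (x : ZMod (q.gcd Q)) ≠ 0 :=
  (DirichletCharacter.apply_ne_zero_iff _ x).2
    (hx.of_isCoprime_of_dvd_right (Int.natCast_dvd_natCast.2 (Nat.gcd_dvd_right q Q)))

theorem isCoprime_gcd {Q R : ℕ} (hQR : Q.Coprime R) (q : ℕ) :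
    IsCoprime ((q.gcd R : ℕ) : ℤ) (Q : ℤ) :=
  Nat.isCoprime_iff_coprime.2 (hQR.coprime_dvd_right (Nat.gcd_dvd_right q R)).symm

theorem localPart_congr {q Q R : ℕ} (hQR : Q.Coprime R) (hq : q ∣ Q * R)
    (χ : DirichletCharacter ℂ q) {x y : ℤ} (h : ((q.gcd Q : ℕ) : ℤ) ∣ x - y) :
    localPart hQR hq χ (x : ZMod (q.gcd Q)) = localPart hQR hq χ (y : ZMod (q.gcd Q)) := by
  rw [intCast_eq_of_dvd h]

theorem localPart_mul {q Q R : ℕ} (hQR : Q.Coprime R) (hq : q ∣ Q * R)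
    (χ : DirichletCharacter ℂ q) (x y : ℤ) :
    localPart hQR hq χ ((x * y : ℤ) : ZMod (q.gcd Q)) =
      localPart hQR hq χ (x : ZMod (q.gcd Q)) * localPart hQR hq χ (y : ZMod (q.gcd Q)) := by
  rw [Int.cast_mul, map_mul]

/-- Modulo each local level one of the two summands drops out, so every local character sees only x
or only y, and their product rebuilds χ₁(x)χ₂(y). The leftover values at u, r, t, v are compensated
by C. -/
theorem prodChar_atkinLehner (hQR : Q.Coprime R) (hN : q₁ * q₂ = Q * R) {r₀ u₀ : ℤ}
    (hr₀ : IsCoprime r₀ (R : ℤ)) (hu₀ : IsCoprime u₀ (Q : ℤ)) (W : AtkinLehner Q R r₀ u₀)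
    (x y : ℤ) :
    χ₁ (x : ZMod q₁) * χ₂ (y : ZMod q₂) = pseudoC hQR hN χ₁ χ₂ r₀ u₀ *
      (swapFst hQR hN χ₁ χ₂ ((x * (q₂.gcd Q * W.r) + y * (q₁.gcd R * W.u) : ℤ) : ZMod _) *
        swapSnd hQR hN χ₁ χ₂ ((x * (q₂.gcd R * W.t) + y * (q₁.gcd Q * W.v) : ℤ) : ZMod _)) := by
  have h₁ : q₁ ∣ R * Q := mul_comm Q R ▸ dvd_fst hN
  have h₂ : q₂ ∣ R * Q := mul_comm Q R ▸ dvd_snd hN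
  have hNR : q₁ * q₂ ∣ R * Q := mul_comm Q R ▸ hN.dvd
  have eQ : ((q₁.gcd Q : ℕ) : ℤ) * (q₂.gcd Q : ℕ) = Q := by
    exact_mod_cast gcd_mul_gcd_eq hQR hN
  have eR : ((q₁.gcd R : ℕ) : ℤ) * (q₂.gcd R : ℕ) = R := by
    exact_mod_cast gcd_mul_gcd_eq hQR.symm (hN.trans (mul_comm Q R))
  have hdet := W.det_eq
  obtain ⟨k, hk⟩ := W.u_modEq.symm.dvd
  obtain ⟨l, hl⟩ := W.r_modEq.symm.dvd
  rw [swapFst_intCast hQR hN χ₁ χ₂ h₁, swapSnd_intCast hQR hN χ₁ χ₂ h₂, pseudoC,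
    localPart_nebentypus hQR hN.dvd (dvd_fst hN) (dvd_snd hN), MulChar.inv_apply_eq_inv',
    localPart_nebentypus hQR.symm hNR h₁ h₂,
    localPart_mul_localPart_intCast hQR (dvd_fst hN) h₁ χ₁ x,
    localPart_mul_localPart_intCast hQR (dvd_snd hN) h₂ χ₂ y]
  rw [localPart_congr hQR (dvd_snd hN) χ₂ (x := x * (q₂.gcd Q * W.r) + y * (q₁.gcd R * W.u))
      (y := y * (q₁.gcd R * u₀))
      ⟨x * W.r + y * q₁.gcd R * q₁.gcd Q * k, by
        rw [← eQ] at hk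
        linear_combination (y * q₁.gcd R) * hk⟩,
    localPart_congr hQR.symm h₁ χ₁ (x := x * (q₂.gcd Q * W.r) + y * (q₁.gcd R * W.u))
      (y := x * (q₂.gcd Q * r₀))
      ⟨x * q₂.gcd Q * q₂.gcd R * l + y * W.u, by
        rw [← eR] at hl
        linear_combination (x * q₂.gcd Q) * hl⟩,
    localPart_congr hQR (dvd_fst hN) χ₁ (x := x * (q₂.gcd R * W.t) + y * (q₁.gcd Q * W.v))
      (y := x * (q₂.gcd R * W.t)) ⟨y * W.v, by ring⟩,
    localPart_congr hQR.symm h₂ χ₂ (x := x * (q₂.gcd R * W.t) + y * (q₁.gcd Q * W.v))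
      (y := y * (q₁.gcd Q * W.v)) ⟨x * W.t, by ring⟩]
  simp only [localPart_mul hQR (dvd_snd hN) χ₂ y, localPart_mul hQR.symm h₁ χ₁ x,
    localPart_mul hQR (dvd_fst hN) χ₁ x, localPart_mul hQR.symm h₂ χ₂ y]
  have n1 := localPart_ne_zero hQR (dvd_snd hN) χ₂ ((isCoprime_gcd hQR q₁).mul_left hu₀)
  have n2 := localPart_ne_zero hQR.symm h₁ χ₁ ((isCoprime_gcd hQR.symm q₂).mul_left hr₀)
  -- The determinant relation gives -Ru₀t ≡ 1 modulo Q here, and Qr₀v ≡ 1 modulo R in `m2`; this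
  -- eliminates t and v.
  have m1 : localPart hQR (dvd_fst hN) χ₁ (-1) *
      localPart hQR (dvd_fst hN) χ₁ ((q₁.gcd R * u₀ : ℤ) : ZMod (q₁.gcd Q)) *
      localPart hQR (dvd_fst hN) χ₁ ((q₂.gcd R * W.t : ℤ) : ZMod (q₁.gcd Q)) = 1 := by
    have e : (-1 : ZMod (q₁.gcd Q)) = ((-1 : ℤ) : ZMod (q₁.gcd Q)) := by simp
    rw [e, ← localPart_mul, ← localPart_mul, localPart_congr (y := 1), Int.cast_one, map_one]
    refine ⟨q₂.gcd Q * (R * W.t * k - W.r * W.v), ?_⟩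
    rw [← eQ, ← eR] at hdet
    rw [← eQ] at hk
    rw [← eR]
    linear_combination hdet + (q₁.gcd R * q₂.gcd R * W.t) * hk
  have m2 : localPart hQR.symm h₂ χ₂ ((q₂.gcd Q * r₀ : ℤ) : ZMod (q₂.gcd R)) *
      localPart hQR.symm h₂ χ₂ ((q₁.gcd Q * W.v : ℤ) : ZMod (q₂.gcd R)) = 1 := by
    rw [← localPart_mul, localPart_congr (y := 1), Int.cast_one, map_one]
    refine ⟨q₁.gcd R * (W.u * W.t - Q * W.v * l), ?_⟩
    rw [← eQ, ← eR] at hdet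
    rw [← eR] at hl
    rw [← eQ]
    linear_combination hdet - (q₁.gcd Q * q₂.gcd Q * W.v) * hl
  generalize localPart hQR (dvd_fst hN) χ₁ (-1) = a at *
  generalize localPart hQR (dvd_snd hN) χ₂ ((q₁.gcd R * u₀ : ℤ) : ZMod (q₂.gcd Q)) = b at *
  generalize localPart hQR.symm h₁ χ₁ ((q₂.gcd Q * r₀ : ℤ) : ZMod (q₁.gcd R)) = c at *
  generalize localPart hQR (dvd_fst hN) χ₁ ((q₁.gcd R * u₀ : ℤ) : ZMod (q₁.gcd Q)) = d at *
  generalize localPart hQR (dvd_fst hN) χ₁ ((q₂.gcd R * W.t : ℤ) : ZMod (q₁.gcd Q)) = e at *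
  generalize localPart hQR.symm h₂ χ₂ ((q₂.gcd Q * r₀ : ℤ) : ZMod (q₂.gcd R)) = f at *
  generalize localPart hQR.symm h₂ χ₂ ((q₁.gcd Q * W.v : ℤ) : ZMod (q₂.gcd R)) = g at *
  have nf : f ≠ 0 := left_ne_zero_of_mul_eq_one m2
  have hbc : a * (d * b⁻¹) * (c * f⁻¹)⁻¹ * b * c * e * g = 1 := by
    field_simp
    linear_combination m1 * (f * g) + m2
  linear_combination -(localPart hQR (dvd_fst hN) χ₁ (x : ZMod (q₁.gcd Q)) *
    localPart hQR.symm h₁ χ₁ (x : ZMod (q₁.gcd R)) *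
    localPart hQR (dvd_snd hN) χ₂ (y : ZMod (q₂.gcd Q)) *
    localPart hQR.symm h₂ χ₂ (y : ZMod (q₂.gcd R))) * hbc

theorem phiAL_const [NeZero q₁] [NeZero q₂] [NeZero Q] (hχ₁ : χ₁.IsPrimitive) (hχ₂ : χ₂.IsPrimitive) (hq : q₁ * q₂ ≠ 1)
    (hpar : χ₁ (-1) * χ₂ (-1) = 1) (hQR : Q.Coprime R) (hN : q₁ * q₂ = Q * R) {r₀ u₀ : ℤ}
    (hr₀ : IsCoprime r₀ (R : ℤ)) (hu₀ : IsCoprime u₀ (Q : ℤ)) (W : AtkinLehner Q R r₀ u₀)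
    (z w : ℍ) : phiAL hQR hN χ₁ χ₂ W z = phiAL hQR hN χ₁ χ₂ W w := by
  have hdet := W.det_eq
  have hlev := swap_level_mul hQR hN
  have eQ := gcd_mul_gcd_eq hQR hN
  have eR := gcd_mul_gcd_eq hQR.symm (hN.trans (mul_comm Q R))
  have e₂ := gcd_mul_gcd hQR (dvd_snd hN)
  have eQC : (Q : ℂ) = (q₁.gcd Q : ℕ) * (q₂.gcd Q : ℕ) := by exact_mod_cast eQ.symm
  have eRC : (R : ℂ) = (q₁.gcd R : ℕ) * (q₂.gcd R : ℕ) := by exact_mod_cast eR.symm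
  have e₂C : (q₂ : ℂ) = (q₂.gcd Q : ℕ) * (q₂.gcd R : ℕ) := by exact_mod_cast e₂.symm
  have hQ : (0 : ℝ) < Q := Nat.cast_pos.2 (Nat.pos_of_ne_zero (NeZero.ne Q))
  have hdetR : ((Q * W.r : ℤ) : ℝ) * ((Q * W.v : ℤ) : ℝ) -
      (W.t : ℝ) * ((Q * R * W.u : ℤ) : ℝ) = Q := by
    have h : (Q : ℤ) * W.r * (Q * W.v) - W.t * (Q * R * W.u) = Q := by
      linear_combination (Q : ℤ) * hdet
    exact_mod_cast h
  have hdetC : (((Q * W.r : ℤ) : ℝ) : ℂ) * ((Q * W.v : ℤ) : ℝ) -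
      (W.t : ℝ) * (((Q * R * W.u : ℤ) : ℝ) : ℂ) = Q := by
    exact_mod_cast congrArg Complex.ofReal hdetR
  have hpos : 0 < ((Q * W.r : ℤ) : ℝ) * ((Q * W.v : ℤ) : ℝ) -
      (W.t : ℝ) * ((Q * R * W.u : ℤ) : ℝ) := by rw [hdetR]; exact hQ
  simp only [phiAL, eisF_eq_eisFExt, coe_toGL_smul]
  refine eisFExt_moebius_const χ₁ χ₂ _ _ hpos _ (fun z hz => ?_) z.2 w.2
  have hj := moebius_denom_ne_zero hpos hz
  have hg₁ : ((q₂.gcd Q : ℕ) : ℂ) ≠ 0 := Nat.cast_ne_zero.2 (NeZero.ne _)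
  have hg₂ : ((q₁.gcd Q : ℕ) : ℂ) ≠ 0 := Nat.cast_ne_zero.2 (NeZero.ne _)
  have hg₃ : ((q₂.gcd R : ℕ) : ℂ) ≠ 0 := Nat.cast_ne_zero.2 (NeZero.ne _)
  -- Expressing W_Q in the bases (q₂w, 1) and (q₂'z, 1) and removing the factor k = (q₂, Q) leaves a
  -- unimodular matrix, since (q₁, Q)(q₂, Q) = Q and likewise for R.
  have key := eisDeriv_transform (N := q₁ * q₂) (dvd_mul_right _ _) (dvd_mul_left _ _)
    (Dvd.intro _ hlev) (Dvd.intro_left _ hlev) hχ₁ hχ₂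
    (isPrimitive_swapFst hQR hN hχ₁ hχ₂) (isPrimitive_swapSnd hQR hN hχ₁ hχ₂) hq
    (by rwa [hlev]) hpar (swap_neg_one hQR hN hpar) hz
    (moebius_im_pos hpos hz) hj hg₁
    (a := q₂.gcd Q * W.r) (b := q₂.gcd R * W.t) (c := q₁.gcd R * W.u) (d := q₁.gcd Q * W.v)
    (by
      have eQZ : ((q₁.gcd Q : ℕ) : ℤ) * (q₂.gcd Q : ℕ) = Q := by exact_mod_cast eQ
      have eRZ : ((q₁.gcd R : ℕ) : ℤ) * (q₂.gcd R : ℕ) = R := by exact_mod_cast eR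
      linear_combination hdet + W.r * W.v * eQZ - W.u * W.t * eRZ)
    (by
      field_simp
      push_cast
      rw [e₂C, eQC]
      ring)
    (by
      push_cast
      rw [eQC, eRC]
      ring)
    (prodChar_atkinLehner hQR hN hr₀ hu₀ W)
  rw [hdetC, mul_div_left_comm, key, beta]
  have hτ := tau_ne_zero hχ₂
  push_cast
  rw [eQC, e₂C]
  field_simp

/-- The characters of `γ` and `γ'` agree when `W γ = γ' W'`. -/
theorem charMat_swap_eq [NeZero Q] (hQR : Q.Coprime R) (hN : q₁ * q₂ = Q * R) {r₀ u₀ : ℤ}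
    {W W' : AtkinLehner Q R r₀ u₀} {γ γ' : SL(2, ℤ)}
    (hγ : ((q₁ * q₂ : ℕ) : ℤ) ∣ γ 1 0) (hγ' : ((q₁ * q₂ : ℕ) : ℤ) ∣ γ' 1 0)
    (hW : W.mat * (γ : Matrix (Fin 2) (Fin 2) ℤ) = (γ' : Matrix (Fin 2) (Fin 2) ℤ) * W'.mat) :
    charMat (nebentypus χ₁ χ₂) γ' =
      charMat (nebentypus (swapFst hQR hN χ₁ χ₂) (swapSnd hQR hN χ₁ χ₂)) γ := by
  have h₁ : q₁ ∣ R * Q := mul_comm Q R ▸ dvd_fst hN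
  have h₂ : q₂ ∣ R * Q := mul_comm Q R ▸ dvd_snd hN
  rw [hN] at hγ hγ'
  obtain ⟨c, hc⟩ := hγ
  obtain ⟨c', hc'⟩ := hγ'
  push_cast at hc hc'
  have hQ : (Q : ℤ) ≠ 0 := Nat.cast_ne_zero.2 (NeZero.ne Q)
  have hdet := W.det_eq
  have hdet' := W'.det_eq
  have hg := γ.det_coe
  have hg' := γ'.det_coe
  rw [Matrix.det_fin_two, hc] at hg
  rw [Matrix.det_fin_two, hc'] at hg'
  have E01 := congrFun (congrFun hW 0) 1
  have E11 := congrFun (congrFun hW 1) 1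
  simp only [AtkinLehner.mat, Matrix.mul_apply, Fin.sum_univ_two, Matrix.of_apply,
    Matrix.cons_val', Matrix.cons_val_zero, Matrix.cons_val_one, Matrix.cons_val_fin_one, hc'] at E01 E11
  obtain ⟨k, hk⟩ := (W.u_modEq.trans W'.u_modEq.symm).dvd
  obtain ⟨l, hl⟩ := (W.r_modEq.trans W'.r_modEq.symm).dvd
  rw [charMat, charMat, nebentypus_intCast, nebentypus_intCast,
    swapFst_intCast hQR hN χ₁ χ₂ h₁, swapSnd_intCast hQR hN χ₁ χ₂ h₂,
    localPart_mul_localPart_intCast hQR (dvd_fst hN) h₁ χ₁ (γ' 1 1),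
    localPart_mul_localPart_intCast hQR (dvd_snd hN) h₂ χ₂ (γ' 1 1)]
  generalize γ 0 0 = a at *
  generalize γ 0 1 = b at *
  generalize γ 1 1 = d at *
  generalize γ' 0 0 = a' at *
  generalize γ' 0 1 = b' at *
  generalize γ' 1 1 = d' at *
  have E11' : (R : ℤ) * W.u * b + W.v * d = R * c' * W'.t + d' * W'.v := by
    apply mul_left_cancel₀ hQ
    linear_combination E11
  -- Modulo R, lower right entries give vd ≡ v'd', and Qrv ≡ 1 with r ≡ r' forces v ≡ v'.
  have hR : (R : ℤ) ∣ d - d' := by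
    refine ⟨Q * (W.r * c' * W'.t - W.r * W.u * b - l * W'.v * d') + W'.u * W'.t * d' -
      W.u * W.t * d, ?_⟩
    linear_combination -d * hdet + d' * hdet' + Q * W.r * E11' - Q * W'.v * d' * hl
  -- Modulo Q, upper right entries give td ≡ a't'. From -Rut ≡ 1 and u ≡ u' follows t ≡ t', so d ≡
  -- a', the inverse of d'.
  have hQd : (Q : ℤ) ∣ d * d' - 1 := by
    refine ⟨b' * R * c' + (W.r * W.v * d - R * W.u * (b' * W'.v - W.r * b) - a' * W'.r * W'.v +
      R * k * a' * W'.t) * d', ?_⟩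
    linear_combination -(d * d') * hdet - R * W.u * d' * E01 + R * a' * W'.t * d' * hk +
      a' * d' * hdet' + hg'
  have cR : ∀ {q : ℕ} (h : q ∣ R * Q) (χ : DirichletCharacter ℂ q),
      localPart hQR.symm h χ (d' : ZMod (q.gcd R)) =
        localPart hQR.symm h χ (d : ZMod (q.gcd R)) := fun {q} h χ =>
    (localPart_congr hQR.symm h χ
      ((Int.natCast_dvd_natCast.2 (Nat.gcd_dvd_right q R)).trans hR)).symm
  have cQ : ∀ {q : ℕ} (h : q ∣ Q * R) (χ : DirichletCharacter ℂ q),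
      localPart hQR h χ (d' : ZMod (q.gcd Q)) =
        (localPart hQR h χ (d : ZMod (q.gcd Q)))⁻¹ := fun {q} h χ => by
    refine eq_inv_of_mul_eq_one_right ?_
    rw [← localPart_mul, localPart_congr (y := 1) hQR h χ
      ((Int.natCast_dvd_natCast.2 (Nat.gcd_dvd_right q Q)).trans hQd), Int.cast_one, map_one]
  -- Passing from ψ to ψ' inverts exactly the Q-part, matching the inversion d' ≡ d⁻¹ modulo Q.
  rw [cR h₁, cR h₂, cQ, cQ, mul_inv, mul_inv, inv_inv]
  ring

end AtkinLehner

end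

end NewformDedekind

/-! ### The reciprocity formula -/

theorem theorem3p1 {q₁ q₂ Q R : ℕ} [NeZero q₁] [NeZero q₂] [NeZero Q]
    (χ₁ : DirichletCharacter ℂ q₁) (χ₂ : DirichletCharacter ℂ q₂)
    (hχ₁ : χ₁.IsPrimitive) (hχ₂ : χ₂.IsPrimitive)
    (hq : 1 < q₁ * q₂) (hpar : χ₁ (-1) * χ₂ (-1) = 1)
    (hQR : Q.Coprime R) (hN : q₁ * q₂ = Q * R)
    (r₀ u₀ : ℤ) (hr₀ : IsCoprime r₀ (R : ℤ)) (hu₀ : IsCoprime u₀ (Q : ℤ))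
    (W W' : NewformDedekind.AtkinLehner Q R r₀ u₀)
    (γ γ' : Matrix.SpecialLinearGroup (Fin 2) ℤ)
    (hγ : γ ∈ CongruenceSubgroup.Gamma0 (q₁ * q₂))
    (hγ' : γ' ∈ CongruenceSubgroup.Gamma0 (q₁ * q₂))
    (hW : W.mat * (γ : Matrix (Fin 2) (Fin 2) ℤ) = (γ' : Matrix (Fin 2) (Fin 2) ℤ) * W'.mat) :
    -- the four functions whose values define the Dedekind sums below are constant
    (∀ z w : UpperHalfPlane, NewformDedekind.phiAL hQR hN χ₁ χ₂ W z =
      NewformDedekind.phiAL hQR hN χ₁ χ₂ W w) ∧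
    (∀ z w : UpperHalfPlane, NewformDedekind.phi (NewformDedekind.swapFst hQR hN χ₁ χ₂)
        (NewformDedekind.swapSnd hQR hN χ₁ χ₂) γ z =
      NewformDedekind.phi (NewformDedekind.swapFst hQR hN χ₁ χ₂)
        (NewformDedekind.swapSnd hQR hN χ₁ χ₂) γ w) ∧
    (∀ z w : UpperHalfPlane, NewformDedekind.phiAL hQR hN χ₁ χ₂ W' z =
      NewformDedekind.phiAL hQR hN χ₁ χ₂ W' w) ∧
    (∀ z w : UpperHalfPlane, NewformDedekind.phi χ₁ χ₂ γ' z =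
      NewformDedekind.phi χ₁ χ₂ γ' w) ∧
    -- the reciprocity formula
    NewformDedekind.dedekindSumAL hQR hN χ₁ χ₂ W +
        NewformDedekind.xi hQR hN χ₁ χ₂ r₀ u₀ *
          NewformDedekind.dedekindSum (NewformDedekind.swapFst hQR hN χ₁ χ₂)
            (NewformDedekind.swapSnd hQR hN χ₁ χ₂) γ =
      NewformDedekind.charMat (NewformDedekind.nebentypus
          (NewformDedekind.swapFst hQR hN χ₁ χ₂)
          (NewformDedekind.swapSnd hQR hN χ₁ χ₂)) γ *
        NewformDedekind.dedekindSumAL hQR hN χ₁ χ₂ W' +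
        NewformDedekind.dedekindSum χ₁ χ₂ γ' := by
  have hdvd : ((q₁ * q₂ : ℕ) : ℤ) ∣ γ 1 0 :=
    (ZMod.intCast_zmod_eq_zero_iff_dvd _ _).1 (CongruenceSubgroup.Gamma0_mem.1 hγ)
  have hdvd' : ((q₁ * q₂ : ℕ) : ℤ) ∣ γ' 1 0 :=
    (ZMod.intCast_zmod_eq_zero_iff_dvd _ _).1 (CongruenceSubgroup.Gamma0_mem.1 hγ')
  have hlev := NewformDedekind.swap_level_mul hQR hN
  have hp₁ := NewformDedekind.isPrimitive_swapFst hQR hN hχ₁ hχ₂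
  have hp₂ := NewformDedekind.isPrimitive_swapSnd hQR hN hχ₁ hχ₂
  have cW := NewformDedekind.phiAL_const hχ₁ hχ₂ hq.ne' hpar hQR hN hr₀ hu₀ W
  have cW' := NewformDedekind.phiAL_const hχ₁ hχ₂ hq.ne' hpar hQR hN hr₀ hu₀ W'
  have cγ := NewformDedekind.phi_const hp₁ hp₂ (by rw [hlev]; exact hq.ne')
    (NewformDedekind.swap_neg_one hQR hN hpar) (γ := γ) (by rwa [hlev])
  have cγ' := NewformDedekind.phi_const hχ₁ hχ₂ hq.ne' hpar hdvd'
  refine ⟨cW, cγ, cW', cγ', ?_⟩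
  have hτ : NewformDedekind.tau (NewformDedekind.swapFst hQR hN χ₁ χ₂)⁻¹ ≠ 0 :=
    NewformDedekind.tau_ne_zero ((DirichletCharacter.isPrimitive_def _).2
      ((DirichletCharacter.conductor_inv _).trans hp₁))
  have hpi : (Real.pi : ℂ) ≠ 0 := Complex.ofReal_ne_zero.2 Real.pi_ne_zero
  have hsmul : W.toGL • (γ • UpperHalfPlane.I) = γ' • (W'.toGL • UpperHalfPlane.I) := by
    change W.toGL • (Matrix.SpecialLinearGroup.mapGL ℝ γ • UpperHalfPlane.I) =
      Matrix.SpecialLinearGroup.mapGL ℝ γ' • (W'.toGL • UpperHalfPlane.I)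
    rw [smul_smul, smul_smul]
    congr 1
    refine Units.ext ?_
    have h := congrArg (fun M : Matrix (Fin 2) (Fin 2) ℤ => M.map (Int.castRingHom ℝ)) hW
    simp only [Matrix.map_mul] at h
    exact h
  -- Constancy moves the base points of φ(W_Q) and φ(γ') to γi and W_Q'i, so that both involve F at
  -- the common point `hsmul`.
  have e1 := cW UpperHalfPlane.I (γ • UpperHalfPlane.I)
  have e2 := cγ' UpperHalfPlane.I (W'.toGL • UpperHalfPlane.I)
  have hchar := NewformDedekind.charMat_swap_eq (χ₁ := χ₁) (χ₂ := χ₂) hQR hN hdvd hdvd' hW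
  rw [NewformDedekind.dedekindSumAL, NewformDedekind.dedekindSumAL, NewformDedekind.dedekindSum,
    NewformDedekind.dedekindSum, NewformDedekind.xi, e1, e2, ← hchar]
  simp only [NewformDedekind.phiAL, NewformDedekind.phi, hsmul, ← hchar]
  field_simp
  ring
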